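/- Let $\lambda\ge 0$, $\eta\ge 1$ and $\alpha_1,\dots,\alpha_\lambda$ be integers with $0<\alpha_1<\cdots<\alpha_\lambda<\eta$ and $\alpha_i=\eta-\alpha_{\lambda+1-i}$ for $1\le i\le\lambda$, and let $k,r$ be integers with $k>r\ge\lambda$ and $k-1>\lambda$. Write $[x]$ for the greatest integer not exceeding $x$. The empty partition (overpartition) is the only one of $0$. For $K\ge 1$, let $B_1(\alpha_1,\dots,\alpha_\lambda;\eta,K,r;n)$ be the number of partitions $\pi=(\pi_1\ge\pi_2\ge\cdots\ge\pi_\ell)$ of $n$ such that: 1. $\pi_i\equiv 0,\alpha_1,\dots,\alpha_\lambda \pmod\eta$ for all $1\le i\le\ell$; 2. only multiples of $\eta$ may be repeated; 3. $\pi_i\ge\pi_{i+K-1}+\eta$ for $1\le i\le \ell-K+1$, with strict inequality if $\eta\mid\pi_i$; 4. at most $r-1$ of the $\pi_i$ are less than or equal to $\eta$. An overpartition of $n$ is a partition of $n$ in which the last occurrence of each part may be overlined. Its parts are ordered by $\bar 1<1<\bar 2<2<\cdots$ and written $\pi_1\ge\cdots\ge\pi_\ell$. Write $|t|=|\bar t|=t$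 for the size of a part; for a positive integer $b$, $t+b$ is the non-overlined and $\bar t+b$ the overlined part of size $t+b$. Let $f_{\le\eta}(\pi)$ be the number of parts of $\pi$ not exceeding the non-overlined part $\eta$. Let $\overline B_0(\alpha_1,\dots,\alpha_\lambda;\eta,k,r;n)$ be the number of overpartitions $\pi$ of $n$ such that: 1. $|\pi_i|\equiv 0,\alpha_1,\dots,\alpha_\lambda\pmod\eta$ for all $1\le i\le\ell$; 2. only multiples of $\eta$ may be non-overlined; 3. $\pi_i\ge\pi_{i+k-1}+\eta$ for $1\le i\le\ell-k+1$, with strict inequality if $\pi_i$ is non-overlined; 4. $f_{\le\eta}(\pi)\le r$; 5. if $f_{\le\eta}(\pi)=r$ and $\overline{\eta}$ does not occur in $\pi$, then there is an $i$ with $1\le i\le\ell-k+2$, $\pi_i<\overline{2\eta}$ and $\pi_i\le\pi_{i+k-2}+\eta$, the last inequality being strict if $\pi_i$ is overlined; 6. for every $1\le i\le\ell-k+2$ with $\pi_i\le\pi_{i+k-2}+\eta$, strictly if $\pi_i$ is overlined, $$[|\pi_i|/\eta]+\cdots+[|\pi_{i+k-2}|/\eta]\equiv r-1+\overline V_\pi(\pi_i)+\overline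 O_\pi(\pi_{i+k-2})\pmod 2,$$ where $\overline V_\pi(\pi_i)$ is the number of overlined parts of $\pi$ not exceeding $\pi_i$ and not divisible by $\eta$, and $\overline O_\pi(\pi_{i+k-2})$ is the number of overlined parts of $\pi$ greater than or equal to $\pi_{i+k-2}$ and divisible by $\eta$. Then for every complex $q$ with $|q|<1$ both series below converge absolutely, the product $(-q^\eta;q^\eta)_\infty=\prod_{i=1}^{\infty}(1+q^{i\eta})$ converges, and $$\sum_{n\ge0}\overline B_0(\alpha_1,\dots,\alpha_\lambda;\eta,k,r;n)\,q^n=(-q^\eta;q^\eta)_\infty\sum_{n\ge0}B_1(\alpha_1,\dots,\alpha_\lambda;\eta,k-1,r;n)\,q^n .$$ -/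

import Mathlib

/-! ## Ordinary partitions: Bressoud's partition functions `B_j` -/

/-- The parts of a partition written as a non-increasing sequence `π₁ ≥ π₂ ≥ ⋯ ≥ π_ℓ`
(the list is indexed from `0`). -/
def Nat.Partition.seq {n : ℕ} (π : Nat.Partition n) : List ℕ :=
  π.parts.sort (· ≥ ·)

/-- `a ≡ 0, α₁, …, α_λ (mod η)`. -/
def AllowedResidue {lam : ℕ} (α : Fin lam → ℕ) (η a : ℕ) : Prop :=
  a ≡ 0 [MOD η] ∨ ∃ s, a ≡ α s [MOD η]

/-- `V_π(N)`: the number of parts of `π` not exceeding `N` and not divisible by `η`. -/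
def Nat.Partition.V {n : ℕ} (π : Nat.Partition n) (η N : ℕ) : ℕ :=
  π.parts.countP (fun a => a ≤ N ∧ ¬ η ∣ a)

/-- The partitions counted by `B_j(α₁, …, α_λ; η, k, r; n)`, for `j = 0` or `1` and `k ≥ 1`.
In `gap` and `parity` the indices `i` start from `0`, and `π.seq[i]? = some a` says that the
sequence has an entry at position `i` and that this entry is `a`. When `j = 1` the congruence in
`parity` is modulo `1`. -/
structure IsBressoudB (j : ℕ) {lam : ℕ} (α : Fin lam → ℕ) (η k r : ℕ) {n : ℕ}
    (π : Nat.Partition n) : Prop where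
  residue : ∀ a ∈ π.parts, AllowedResidue α η a
  repeated : ∀ a ∈ π.parts, 2 ≤ π.parts.count a → η ∣ a
  gap : ∀ i a b, π.seq[i]? = some a → π.seq[i + (k - 1)]? = some b →
    b + η ≤ a ∧ (η ∣ a → b + η < a)
  small : (π.parts.countP (fun a => a ≤ η) : ℤ) ≤ (r : ℤ) - 1
  parity : ∀ i a b, π.seq[i]? = some a → π.seq[i + (k - 2)]? = some b →
    (a ≤ b + η ∧ (¬ η ∣ a → a < b + η)) →
    (((((π.seq.drop i).take (k - 1)).map (fun c : ℕ => c / η)).sum : ℕ) : ℤ)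
      ≡ (r : ℤ) - 1 + π.V η a [ZMOD (2 - (j : ℤ))]

/-- `B_j(α₁, …, α_λ; η, k, r; n)`. -/
noncomputable def bressoudB (j : ℕ) {lam : ℕ} (α : Fin lam → ℕ) (η k r n : ℕ) : ℕ :=
  Set.ncard {π : Nat.Partition n | IsBressoudB j α η k r π}

/-! ## Overpartitions -/

/-- A part of an overpartition: its size, together with `false` if the part is overlined and
`true` if it is not. The lexicographic order is the order `1̄ < 1 < 2̄ < 2 < ⋯`. -/
abbrev OverPart : Type := ℕ ×ₗ Bool

/-- The size of a part. -/
def OverPart.size (a : OverPart) : ℕ := (ofLex a).1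

/-- The part is overlined. -/
def OverPart.IsOverlined (a : OverPart) : Prop := (ofLex a).2 = false

instance : DecidablePred OverPart.IsOverlined :=
  fun a => inferInstanceAs (Decidable ((ofLex a).2 = false))

/-- The overlined part `t̄`. -/
def OverPart.overlined (t : ℕ) : OverPart := toLex (t, false)

/-- The non-overlined part `t`. -/
def OverPart.plain (t : ℕ) : OverPart := toLex (t, true)

/-- `a + b`: the size is increased by `b` and the part stays overlined or non-overlined. -/
def OverPart.shift (a : OverPart) (b : ℕ) : OverPart := toLex ((ofLex a).1 + b, (ofLex a).2)

/-- An overpartition of `n`: a partition of `n` in which at most one occurrence of each part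
(the last one, in the non-increasing order of parts) is overlined. -/
@[ext]
structure Overpartition (n : ℕ) where
  parts : Multiset OverPart
  parts_pos : ∀ a ∈ parts, 0 < a.size
  parts_sum : (parts.map OverPart.size).sum = n
  overlined_once : ∀ t, parts.count (OverPart.overlined t) ≤ 1

namespace Overpartition

variable {n : ℕ}

/-- The parts in non-increasing order, `π₁ ≥ π₂ ≥ ⋯ ≥ π_ℓ` (indexed from `0`). -/
def seq (π : Overpartition n) : List OverPart :=
  π.parts.sort (· ≥ ·)

/-- `f_{≤ η}(π)`: the number of parts not exceeding the non-overlined part `η`. -/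
def fLe (π : Overpartition n) (η : ℕ) : ℕ :=
  π.parts.countP (fun a => a ≤ OverPart.plain η)

/-- `V̄_π(N)`: the number of overlined parts not exceeding `N` and not divisible by `η`. -/
def V (π : Overpartition n) (η : ℕ) (N : OverPart) : ℕ :=
  π.parts.countP (fun a => a.IsOverlined ∧ a ≤ N ∧ ¬ η ∣ a.size)

/-- `Ō_π(N)`: the number of overlined parts greater than or equal to `N` and divisible by `η`. -/
def O (π : Overpartition n) (η : ℕ) (N : OverPart) : ℕ :=
  π.parts.countP (fun a => a.IsOverlined ∧ N ≤ a ∧ η ∣ a.size)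

end Overpartition

/-- For the first part `a` and the last part `b` of a run of consecutive parts:
`a ≤ b + η`, with strict inequality if `a` is overlined. -/
def BandEnds (η : ℕ) (a b : OverPart) : Prop :=
  a ≤ b.shift η ∧ (a.IsOverlined → a < b.shift η)

/-- The overpartitions counted by `B̄₀(α₁, …, α_λ; η, k, r; n)`, for `k ≥ 2`.
The indices `i` start from `0`. -/
structure IsOverB0 {lam : ℕ} (α : Fin lam → ℕ) (η k r : ℕ) {n : ℕ}
    (π : Overpartition n) : Prop where
  residue : ∀ a ∈ π.parts, AllowedResidue α η a.size
  nonoverlined : ∀ a ∈ π.parts, ¬ a.IsOverlined → η ∣ a.size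
  gap : ∀ i a b, π.seq[i]? = some a → π.seq[i + (k - 1)]? = some b →
    b.shift η ≤ a ∧ (¬ a.IsOverlined → b.shift η < a)
  small : π.fLe η ≤ r
  small_eq : π.fLe η = r → OverPart.overlined η ∉ π.parts →
    ∃ i a b, π.seq[i]? = some a ∧ π.seq[i + (k - 2)]? = some b ∧
      a < OverPart.overlined (2 * η) ∧ BandEnds η a b
  parity : ∀ i a b, π.seq[i]? = some a → π.seq[i + (k - 2)]? = some b → BandEnds η a b →
    (((((π.seq.drop i).take (k - 1)).map (fun c => c.size / η)).sum : ℕ) : ℤ)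
      ≡ (r : ℤ) - 1 + π.V η a + π.O η b [ZMOD 2]

/-- `B̄₀(α₁, …, α_λ; η, k, r; n)`. -/
noncomputable def overB0 {lam : ℕ} (α : Fin lam → ℕ) (η k r n : ℕ) : ℕ :=
  Set.ncard {π : Overpartition n | IsOverB0 α η k r π}

/-- `(a; q)_∞ = ∏_{i ≥ 0} (1 - a qⁱ)`. -/
noncomputable def qPochhammerInf (a q : ℂ) : ℂ := ∏' i : ℕ, (1 - a * q ^ i)

/-! Put κ = k - 1 and call an interval of parts whose ends satisfy `BandEnds` a window. The gap
condition for overpartitions says that no window has more than κ parts, and the parity condition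
restricts the full windows, those with exactly κ parts. For ordinary partitions with parameter k -
1, read as overpartitions by overlining exactly the non-multiples of η, the gap condition says that
no window has more than κ - 1 parts. Modulo 1 there is no parity condition.

Cut the parts into rows. By `between_le_between` only two kinds of windows matter apart from row 0:
the closed ones from the plain part jη to the plain part (j + 1)η, and the crossing ones from inside
row j to inside row j + 1. For a full window the sum of the integer parts can be eliminated with the
help of its cardinality κ. What is left is a bit t that is common to the closed window starting at a
row and to the crossing windows ending in that row (`windowParity_closed_iff`,
`windowParity_crossing_iff`). This bit is `tbit`. Both conditions together therefore become "number
of parts + t ≤ κ".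

The bit of the next row is determined by the contents of the two rows and by h = f + t, where f
counts the plain multiples of the row. Hence the generating function obeys a transfer recursion with
state h (`overSum`). Adding the states h = f and h = f + 1, each pair (e', t') of an overlining
number and a bit for the next row occurs exactly once. With u the weight of a multiple in that row
and f' the number of its plain multiples, the four pairs give (1 + u) u^f' (n(f') + n(f' + 1)),
which is a factor 1 + u times the recursion for windows with at most κ - 1 parts. At the boundary D
of the range of f' one term fails, (f', e', t') = (D - 1, 1, 1), and one extra term appears, (D, 0,
0). Both equal u^D n(D), so they compensate (`sum_transfer_step`). Induction gives
`overSum_add_overSum`.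

At the bottom, the bit of row 1 is free and the bound r replaces the closed window. The condition
for exactly r small parts keeps the extra term exactly when a term is missing (`sum_initial_step`).
This yields the exact identity `sum_overRows_eq` for parts less than η(n + 2), with a finite
product. A bound uniform in n allows the passage to the limit. -/

/-! ## Rows

The parts of size `j * η, …, j * η + η - 1` form the `j`-th row of an overpartition. It is
recorded by the number of overlined and of plain parts `j * η` and by the set of the residues of
the other parts. -/

/-- The number of overlined multiples, the number of plain multiples, and the residues. -/
abbrev Row : Type := ℕ × ℕ × Finset ℕ

/-- The largest number of non-multiples of `η` in a half-open window of length `η` that covers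
the end of a row with residues `x` and the beginning of the next row, with residues `x'`. -/
def crossing (η : ℕ) (x x' : Finset ℕ) : ℕ :=
  (Finset.range η).sup fun ρ => (x.filter (ρ < ·)).card + (x'.filter (· ≤ ρ)).card

theorem crossing_add_le {η : ℕ} (hη : 0 < η) (x x' : Finset ℕ) (a N : ℕ) :
    crossing η x x' + a ≤ N ↔
      ∀ ρ < η, (x.filter (ρ < ·)).card + (x'.filter (· ≤ ρ)).card + a ≤ N := by
  constructor
  · intro h ρ hρ
    have := Finset.le_sup (f := fun ρ => (x.filter (ρ < ·)).card + (x'.filter (· ≤ ρ)).card)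
      (Finset.mem_range.2 hρ)
    simp only [crossing] at h
    omega
  · intro h
    obtain ⟨ρ, hρ, e⟩ := Finset.exists_mem_eq_sup (Finset.range η) ⟨0, Finset.mem_range.2 hη⟩
      (fun ρ => (x.filter (ρ < ·)).card + (x'.filter (· ≤ ρ)).card)
    rw [crossing, e]
    exact h ρ (Finset.mem_range.1 hρ)

theorem exists_crossing_eq {η : ℕ} (hη : 0 < η) (x x' : Finset ℕ) :
    ∃ ρ < η, (x.filter (ρ < ·)).card + (x'.filter (· ≤ ρ)).card = crossing η x x' := by
  obtain ⟨ρ, hρ, e⟩ := Finset.exists_mem_eq_sup (Finset.range η) ⟨0, Finset.mem_range.2 hη⟩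
    (fun ρ => (x.filter (ρ < ·)).card + (x'.filter (· ≤ ρ)).card)
  exact ⟨ρ, Finset.mem_range.1 hρ, e.symm⟩

theorem le_crossing {η ρ : ℕ} (hρ : ρ < η) (x x' : Finset ℕ) :
    (x.filter (ρ < ·)).card + (x'.filter (· ≤ ρ)).card ≤ crossing η x x' :=
  Finset.le_sup (f := fun ρ => (x.filter (ρ < ·)).card + (x'.filter (· ≤ ρ)).card)
    (Finset.mem_range.2 hρ)

theorem card_le_crossing_left {η : ℕ} (hη : 0 < η) {x x' : Finset ℕ} (hx : ∀ ρ ∈ x, 0 < ρ) :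
    x.card ≤ crossing η x x' := by
  have := le_crossing hη x x'
  rw [Finset.filter_true_of_mem hx] at this
  omega

theorem card_le_crossing_right {η : ℕ} (hη : 0 < η) {x x' : Finset ℕ} (hx : ∀ ρ ∈ x', ρ < η) :
    x'.card ≤ crossing η x x' := by
  have := le_crossing (Nat.sub_lt hη Nat.one_pos) x x'
  rw [Finset.filter_true_of_mem (s := x') (fun ρ h => by have := hx ρ h; omega)] at this
  omega

/-- A crossing window has length η, so it meets every residue at most once: above ρ in the lower row
or at most ρ in the upper one. With fewer than κ residues, a window without multiples is never full.
-/
theorem crossing_le_card {η : ℕ} {x x' R : Finset ℕ} (hx : x ⊆ R) (hx' : x' ⊆ R) :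
    crossing η x x' ≤ R.card := by
  refine Finset.sup_le fun ρ _ => ?_
  rw [← Finset.card_union_of_disjoint]
  · exact Finset.card_le_card (Finset.union_subset ((Finset.filter_subset _ _).trans hx)
      ((Finset.filter_subset _ _).trans hx'))
  · refine Finset.disjoint_left.2 fun a h h' => ?_
    have h1 := (Finset.mem_filter.1 h).2
    have h2 := (Finset.mem_filter.1 h').2
    omega

/-- The number of overlined multiples in a list of rows. -/
def overlines (L : List Row) : ℕ := (L.map Prod.fst).sum

/-- The parity that decides whether a full window at row `m` is allowed (value `0`). -/
def tbit (κ r m f v o : ℕ) : ℕ := ((m + 1) * κ + f + r + 1 + v + o) % 2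

/-- The window conditions for the rows `m, m + 1, …`, where row `m` has `f` plain multiples
and residues `x`, where `v` non-multiples lie in the rows below it, and where `L` lists the rows
above it. -/
def Windows (κ r η : ℕ) : ℕ → ℕ → Finset ℕ → ℕ → List Row → Prop
  | m, f, x, v, [] => f + x.card + tbit κ r m f v 0 ≤ κ
  | m, f, x, v, (e, f', x') :: L =>
    f + x.card + e + f' + tbit κ r m f v (e + overlines L) ≤ κ ∧
    crossing η x x' + (e + f' + tbit κ r (m + 1) f' (v + x.card) (overlines L)) ≤ κ ∧
    Windows κ r η (m + 1) f' x' (v + x.card) L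

/-- The window conditions without overlined multiples and without parity. -/
def PlainWindows (N η : ℕ) : ℕ → Finset ℕ → List Row → Prop
  | f, x, [] => f + x.card ≤ N
  | f, x, (e, f', x') :: L =>
    e = 0 ∧ f + x.card + f' ≤ N ∧ crossing η x x' + f' ≤ N ∧ PlainWindows N η f' x' L

/-- The sum of the sizes of the parts in row `j`. -/
def rowWeight (η j : ℕ) (p : Row) : ℕ := η * j * (p.1 + p.2.1 + p.2.2.card) + ∑ ρ ∈ p.2.2, ρ

/-- The sum of the sizes of the parts in the rows `j, j + 1, …`. -/
def listWeight (η : ℕ) : ℕ → List Row → ℕ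
  | _, [] => 0
  | j, p :: L => rowWeight η j p + listWeight η (j + 1) L

/-- The rows with at most `κ` plain multiples and with residues in `R`. -/
def rowSet (κ : ℕ) (R : Finset ℕ) : Finset Row :=
  Finset.range 2 ×ˢ Finset.range (κ + 1) ×ˢ R.powerset

/-- The lists of `n` such rows. -/
def rowLists (κ : ℕ) (R : Finset ℕ) : ℕ → Finset (List Row)
  | 0 => {[]}
  | n + 1 => (rowSet κ R ×ˢ rowLists κ R n).image fun p => p.1 :: p.2

theorem sum_rowLists_succ {A : Type*} [AddCommMonoid A] (κ : ℕ) (R : Finset ℕ) (n : ℕ)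
    (F : List Row → A) :
    ∑ L ∈ rowLists κ R (n + 1), F L =
      ∑ p ∈ rowSet κ R, ∑ L ∈ rowLists κ R n, F (p :: L) := by
  rw [rowLists, Finset.sum_image, Finset.sum_product]
  rintro ⟨a, b⟩ _ ⟨c, d⟩ _ h
  simpa using h

theorem sum_rowSet {A : Type*} [AddCommMonoid A] (κ : ℕ) (R : Finset ℕ) (F : Row → A) :
    ∑ p ∈ rowSet κ R, F p =
      ∑ x ∈ R.powerset, ∑ f ∈ Finset.range (κ + 1), (F (0, f, x) + F (1, f, x)) := by
  rw [rowSet, Finset.sum_product]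
  simp only [Finset.sum_product, Finset.sum_range_succ (n := 1), Finset.sum_range_one,
    ← Finset.sum_add_distrib]
  rw [Finset.sum_comm]

theorem mem_rowLists {κ : ℕ} {R : Finset ℕ} {n : ℕ} {L : List Row} :
    L ∈ rowLists κ R n ↔ L.length = n ∧ ∀ p ∈ L, p ∈ rowSet κ R := by
  induction n generalizing L with
  | zero => simp +contextual [rowLists]
  | succ n ih =>
    rw [rowLists, Finset.mem_image]
    constructor
    · rintro ⟨⟨a, b⟩, h, rfl⟩
      rw [Finset.mem_product, ih] at h
      exact ⟨by simpa using h.2.1, List.forall_mem_cons.2 ⟨h.1, h.2.2⟩⟩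
    · cases L with
      | nil => simp
      | cons a b =>
        intro h
        refine ⟨(a, b), ?_, rfl⟩
        rw [Finset.mem_product, ih]
        simp only [List.length_cons, add_left_inj, List.mem_cons, forall_eq_or_imp] at h
        exact ⟨h.2.1, h.1, h.2.2⟩

/-! ### The transfer recursion over rows and the pairing of its states -/

section Recursion

variable {A : Type*} [CommRing A]

open Classical in
/-- The generating function of the rows above row `m`, where `h` is the number of plain multiples
in row `m`, increased by `1` if full windows at row `m` are forbidden. -/
noncomputable def overSum (q : A) (κ r η : ℕ) (R : Finset ℕ) : ℕ → ℕ → ℕ → Finset ℕ → ℕ → A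
  | 0, m, h, x, v => if tbit κ r m h v 0 = 0 ∧ h + x.card ≤ κ then 1 else 0
  | n + 1, m, h, x, v => ∑ p ∈ rowSet κ R,
    if h + x.card + p.1 + p.2.1 ≤ κ ∧
      crossing η x p.2.2 + (p.1 + p.2.1 + (κ + h + x.card + p.1 + p.2.1) % 2) ≤ κ
    then q ^ rowWeight η (m + 1) p * overSum q κ r η R n (m + 1)
      (p.2.1 + (κ + h + x.card + p.1 + p.2.1) % 2) p.2.2 (v + x.card)
    else 0

open Classical in
/-- The generating function of the rows above a row with `f` plain multiples and residues `x`, for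
`PlainWindows`. -/
noncomputable def plainSum (q : A) (N κ η : ℕ) (R : Finset ℕ) : ℕ → ℕ → ℕ → Finset ℕ → A
  | 0, _, f, x => if f + x.card ≤ N then 1 else 0
  | n + 1, m, f, x => ∑ p ∈ rowSet κ R,
    if p.1 = 0 ∧ f + x.card + p.2.1 ≤ N ∧ crossing η x p.2.2 + p.2.1 ≤ N
    then q ^ rowWeight η (m + 1) p * plainSum q N κ η R n (m + 1) p.2.1 p.2.2
    else 0

open Classical in
-- The bit depends on rows still to be chosen, through the overlined multiples above. Prescribing
-- its value t makes the conditions local, because t determines the bit of the next row. The state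
-- enters only through f + t.
theorem sum_windows_eq_overSum (q : A) (κ r η : ℕ) (R : Finset ℕ) (n m f : ℕ) (x : Finset ℕ)
    (v t : ℕ) (ht : t < 2) :
    ∑ L ∈ rowLists κ R n, (if Windows κ r η m f x v L ∧ tbit κ r m f v (overlines L) = t
      then q ^ listWeight η (m + 1) L else 0) = overSum q κ r η R n m (f + t) x v := by
  induction n generalizing m f x v t with
  | zero =>
    simp only [rowLists, Finset.sum_singleton, Windows, overSum, listWeight, overlines,
      List.map_nil, List.sum_nil, pow_zero]
    refine if_congr ?_ rfl rfl
    -- With nothing above, the bit for f equals t exactly when the bit computed with f + t in place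
    -- of f vanishes.
    simp only [tbit]
    generalize (m + 1) * κ = z
    omega
  | succ n ih =>
    rw [sum_rowLists_succ, overSum]
    refine Finset.sum_congr rfl ?_
    rintro ⟨e, f', x'⟩ -
    simp only
    have key : ∀ L : List Row,
        (Windows κ r η m f x v ((e, f', x') :: L) ∧
          tbit κ r m f v (overlines ((e, f', x') :: L)) = t) ↔
        (f + t + x.card + e + f' ≤ κ ∧
          crossing η x x' + (e + f' + (κ + (f + t) + x.card + e + f') % 2) ≤ κ) ∧
        (Windows κ r η (m + 1) f' x' (v + x.card) L ∧
          tbit κ r (m + 1) f' (v + x.card) (overlines L) =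
            (κ + (f + t) + x.card + e + f') % 2) := by
      intro L
      have h1 : overlines ((e, f', x') :: L) = e + overlines L := by simp [overlines]
      -- The sum of the two consecutive bits is congruent to κ + f + |x| + e + f' modulo 2: the
      -- counts below and above cancel up to the contents of the two rows.
      have h2 : tbit κ r m f v (e + overlines L) = t ↔
          tbit κ r (m + 1) f' (v + x.card) (overlines L) =
            (κ + (f + t) + x.card + e + f') % 2 := by
        simp only [tbit, add_mul, one_mul]
        generalize m * κ = z
        omega
      rw [Windows, h1, ← h2]
      constructor
      · rintro ⟨⟨a, b, c⟩, d⟩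
        have d' := h2.1 d
        rw [d] at a
        rw [d'] at b
        exact ⟨⟨by omega, b⟩, c, d⟩
      · rintro ⟨⟨a, b⟩, c, d⟩
        rw [d, h2.1 d]
        exact ⟨⟨by omega, b, c⟩, rfl⟩
    split_ifs with hc
    · rw [← ih (m + 1) f' x' (v + x.card) _ (Nat.mod_lt _ two_pos), Finset.mul_sum]
      refine Finset.sum_congr rfl fun L _ => ?_
      rw [mul_ite, mul_zero, listWeight, pow_add]
      refine if_congr ?_ rfl rfl
      rw [key]
      exact and_iff_right hc
    · refine Finset.sum_eq_zero fun L _ => if_neg ?_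
      rw [key]
      exact fun h => hc h.1

open Classical in
theorem sum_plainWindows_eq_plainSum (q : A) (N κ η : ℕ) (R : Finset ℕ) (n m f : ℕ)
    (x : Finset ℕ) :
    ∑ L ∈ rowLists κ R n, (if PlainWindows N η f x L
      then q ^ listWeight η (m + 1) L else 0) = plainSum q N κ η R n m f x := by
  induction n generalizing m f x with
  | zero => simp [rowLists, PlainWindows, plainSum, listWeight]
  | succ n ih =>
    rw [sum_rowLists_succ, plainSum]
    refine Finset.sum_congr rfl ?_
    rintro ⟨e, f', x'⟩ -
    simp only
    split_ifs with hc
    · rw [← ih (m + 1) f' x', Finset.mul_sum]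
      refine Finset.sum_congr rfl fun L _ => ?_
      rw [mul_ite, mul_zero, listWeight, pow_add]
      refine if_congr ?_ rfl rfl
      rw [PlainWindows]
      tauto
    · refine Finset.sum_eq_zero fun L _ => if_neg ?_
      rw [PlainWindows]
      tauto

/-- F arises from G by moving the amount z from the index D - 1 to the index D. Both indices lie in
the range because 0 < D ≤ κ. -/
theorem sum_eq_of_shifted_difference {B : Type*} [AddCommGroup B] {κ D : ℕ} (hD : 0 < D)
    (hDκ : D ≤ κ) (z : B) (F G : ℕ → B)
    (h : ∀ f, F f = G f + (if f = D then z else 0) - (if f + 1 = D then z else 0)) :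
    ∑ f ∈ Finset.range (κ + 1), F f = ∑ f ∈ Finset.range (κ + 1), G f := by
  obtain ⟨d, rfl⟩ : ∃ d, D = d + 1 := ⟨D - 1, by omega⟩
  simp only [h, add_left_inj, Finset.sum_sub_distrib, Finset.sum_add_distrib, Finset.sum_ite_eq',
    Finset.mem_range]
  rw [if_pos (by omega), if_pos (by omega), add_sub_cancel_right]

theorem sum_transfer_step {κ y C : ℕ} (hy : 0 < y) (hyκ : y ≤ κ) (hC : 0 < C) (u : A)
    (n : ℕ → A) :
    ∑ f ∈ Finset.range (κ + 1),
      (((if 0 + f ≤ y ∧ 0 + f + (y + 0 + f) % 2 ≤ C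
          then u ^ (0 + f) * n (f + (y + 0 + f) % 2) else 0) +
        (if 1 + f ≤ y ∧ 1 + f + (y + 1 + f) % 2 ≤ C
          then u ^ (1 + f) * n (f + (y + 1 + f) % 2) else 0)) +
       ((if 0 + f + 1 ≤ y ∧ 0 + f + (y + 1 + f) % 2 ≤ C
          then u ^ (0 + f) * n (f + (y + 1 + f) % 2) else 0) +
        (if 1 + f + 1 ≤ y ∧ 1 + f + (y + 0 + f) % 2 ≤ C
          then u ^ (1 + f) * n (f + (y + 0 + f) % 2) else 0))) =
    ∑ f ∈ Finset.range (κ + 1),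
      (if f + 1 ≤ y ∧ f + 1 ≤ C then (1 + u) * u ^ f * (n f + n (f + 1)) else 0) := by
  refine sum_eq_of_shifted_difference (D := min y C) (by omega) (by omega)
    (u ^ min y C * n (min y C)) _ _ fun f => ?_
  generalize hD : min y C = D
  have hcase : f + 1 < D ∨ f + 1 = D ∨ f = D ∨ D < f := by omega
  have hp : ((y + f) % 2 = 0 ∧ (y + 1 + f) % 2 = 1 ∨
      (y + f) % 2 = 1 ∧ (y + 1 + f) % 2 = 0) := by omega
  rcases hp with ⟨h0, h1⟩ | ⟨h0, h1⟩ <;> simp only [zero_add, add_zero, h0, h1] <;>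
  rcases le_or_gt y C with hle | hle <;> rcases hcase with g | g | g | g <;>
  (repeat (first | rw [if_pos (by omega)] | rw [if_neg (by omega)])) <;>
  (try subst g) <;> ring_nf

theorem pow_rowWeight (q : A) (η j e f : ℕ) (x : Finset ℕ) :
    q ^ rowWeight η j (e, f, x) = q ^ rowWeight η j (0, 0, x) * (q ^ (η * j)) ^ (e + f) := by
  simp only [rowWeight]
  ring

/-- Adding the two states removes the dependence on parity, and with it on v and r. Each row
contributes a factor 1 + q^(ηj), and the bound on the windows drops from κ to κ - 1. -/
theorem overSum_add_overSum (q : A) {κ r η : ℕ} (hη : 0 < η) {R : Finset ℕ} (hRκ : R.card < κ)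
    (hR : ∀ ρ ∈ R, ρ < η) (n m f : ℕ) {x : Finset ℕ} (hx : x ⊆ R) (v : ℕ)
    (hf : f + x.card + 1 ≤ κ) :
    overSum q κ r η R n m f x v + overSum q κ r η R n m (f + 1) x v =
      (∏ j ∈ Finset.range n, (1 + q ^ (η * (m + 1 + j)))) *
        plainSum q (κ - 1) κ η R n m f x := by
  induction n generalizing m f x v with
  | zero =>
    -- The bits for f and f + 1 are opposite, so exactly one of the two sums is 1.
    have e0 : tbit κ r m f v 0 = ((m + 1) * κ + f + r + 1 + v + 0) % 2 := rfl
    have e1 : tbit κ r m (f + 1) v 0 = ((m + 1) * κ + (f + 1) + r + 1 + v + 0) % 2 := rfl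
    simp only [overSum, plainSum, Finset.range_zero, Finset.prod_empty, one_mul]
    rw [if_pos (by omega : f + x.card ≤ κ - 1)]
    rcases Nat.mod_two_eq_zero_or_one ((m + 1) * κ + f + r + 1 + v + 0) with h | h
    · rw [if_pos (by omega), if_neg (by omega), add_zero]
    · rw [if_neg (by omega), if_pos (by omega), zero_add]
  | succ n ih =>
    rw [overSum, overSum, plainSum, sum_rowSet, sum_rowSet, sum_rowSet, ← Finset.sum_add_distrib,
      Finset.mul_sum]
    refine Finset.sum_congr rfl fun x' hx' => ?_
    rw [Finset.mem_powerset] at hx'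
    have hC := crossing_le_card (η := η) hx hx'
    have hX' := card_le_crossing_right hη (x := x) fun ρ h => hR ρ (hx' h)
    -- C and y are the places left in the crossing and in the closed windows. Since κ = f + |x| + y,
    -- the sum κ + f + |x| has the parity of y, as p0 to p3 use below.
    obtain ⟨C, hCeq⟩ : ∃ C, κ = crossing η x x' + C := ⟨κ - crossing η x x', by omega⟩
    obtain ⟨y, hy⟩ : ∃ y, κ = f + x.card + y := ⟨κ - (f + x.card), by omega⟩
    have step := sum_transfer_step (κ := κ) (y := y) (C := C) (by omega) (by omega) (by omega)
      (q ^ (η * (m + 1))) fun h => overSum q κ r η R n (m + 1) h x' (v + x.card)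
    have step' := congrArg (q ^ rowWeight η (m + 1) (0, 0, x') * ·) step
    simp only [Finset.mul_sum] at step'
    rw [← Finset.sum_add_distrib, Finset.mul_sum]
    refine Eq.trans (Finset.sum_congr rfl fun g _ => ?_)
      (step'.trans (Finset.sum_congr rfl fun g _ => ?_))
    · have p0 : (κ + f + x.card + 0 + g) % 2 = (y + 0 + g) % 2 := by omega
      have p1 : (κ + f + x.card + 1 + g) % 2 = (y + 1 + g) % 2 := by omega
      have p2 : (κ + (f + 1) + x.card + 0 + g) % 2 = (y + 1 + g) % 2 := by omega
      have p3 : (κ + (f + 1) + x.card + 1 + g) % 2 = (y + 0 + g) % 2 := by omega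
      simp only [p0, p1, p2, p3, pow_rowWeight q η (m + 1) _ g, mul_add, mul_ite, mul_zero,
        mul_assoc]
      congr 1 <;> congr 1 <;> refine if_congr ?_ rfl rfl <;> omega
    · rw [if_neg (by simp : ¬ ((1, g, x').1 = 0 ∧ _)), add_zero]
      simp only [pow_rowWeight q η (m + 1) 0 g, true_and, mul_ite, mul_zero, zero_add]
      refine ite_congr (propext (by omega)) (fun hc => ?_) fun _ => rfl
      rw [ih (m + 1) g hx' (v + x.card) (by omega), Finset.prod_range_succ']
      simp only [add_assoc, add_comm 1, add_zero, add_left_comm]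
      ring

/-- Now y is what the bound r leaves for the multiples in row 1, and the bit 0 or 1 is free. If y <
C, the clause on equality excludes f = y without an overlined multiple, and the sides agree term by
term. If C ≤ y, the crossing window is the boundary: f = C with no overline and bit 0 is admitted,
also when C = y, and replaces f = C - 1 with an overline and bit 1. If y = 0, both sides vanish. -/
theorem sum_initial_step {κ y C : ℕ} (hyκ : y ≤ κ) (hC : 0 < C) (u : A) (n : ℕ → A) :
    ∑ f ∈ Finset.range (κ + 1),
      (((if (0 + f ≤ y ∧ (0 + f = y → 0 = 0 → 0 + f = C)) ∧ 0 + f + 0 ≤ C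
          then u ^ (0 + f) * n (f + 0) else 0) +
        (if (0 + f ≤ y ∧ (0 + f = y → 0 = 0 → 0 + f = C)) ∧ 0 + f + 1 ≤ C
          then u ^ (0 + f) * n (f + 1) else 0)) +
       ((if (1 + f ≤ y ∧ (1 + f = y → 1 = 0 → 1 + f = C)) ∧ 1 + f + 0 ≤ C
          then u ^ (1 + f) * n (f + 0) else 0) +
        (if (1 + f ≤ y ∧ (1 + f = y → 1 = 0 → 1 + f = C)) ∧ 1 + f + 1 ≤ C
          then u ^ (1 + f) * n (f + 1) else 0))) =
    ∑ f ∈ Finset.range (κ + 1),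
      (if f + 1 ≤ y ∧ f + 1 ≤ C then (1 + u) * u ^ f * (n f + n (f + 1)) else 0) := by
  rcases Nat.eq_zero_or_pos y with rfl | hy
  · refine Finset.sum_congr rfl fun f _ => ?_
    (repeat rw [if_neg (by omega)])
    simp
  rcases lt_or_ge y C with hlt | hle
  · refine Finset.sum_congr rfl fun f _ => ?_
    rcases lt_or_ge f y with hf | hf <;>
    (repeat (first | rw [if_pos (by omega)] | rw [if_neg (by omega)])) <;> ring_nf
  refine sum_eq_of_shifted_difference (D := C) (by omega) (by omega) (u ^ C * n C) _ _ fun f => ?_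
  have hcase : f + 1 < C ∨ f + 1 = C ∨ f = C ∨ C < f := by omega
  rcases hle.eq_or_lt with hle | hle <;> rcases hcase with g | g | g | g <;>
  (repeat (first | rw [if_pos (by omega)] | rw [if_neg (by omega)])) <;>
  (try subst g) <;> ring_nf

end Recursion

/-! ### The two lowest rows and the identity for boundedly many rows -/

/-- The conditions on the parts not exceeding `η` of the overpartitions counted by `overB0`. -/
def SmallRows (κ r η : ℕ) (x : Finset ℕ) : List Row → Prop
  | [] => False
  | (e, f, x') :: _ => x.card + (e + f) ≤ r ∧
    (x.card + (e + f) = r → e = 0 → crossing η x x' + (e + f) = κ)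

/-- The overpartitions counted by `overB0`, given by the residues `x` in row `0` and the list of
the other rows. -/
def OverRows (κ r η : ℕ) (x : Finset ℕ) (L : List Row) : Prop :=
  Windows κ r η 0 0 x 0 L ∧ SmallRows κ r η x L

/-- The condition on the parts not exceeding `η` of the partitions counted by `bressoudB`. -/
def SmallPlainRows (r : ℕ) (x : Finset ℕ) : List Row → Prop
  | [] => False
  | (_, f, _) :: _ => x.card + f + 1 ≤ r

/-- The partitions counted by `bressoudB 1`, given by rows as in `OverRows`. -/
def PlainRows (κ r η : ℕ) (x : Finset ℕ) (L : List Row) : Prop :=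
  PlainWindows (κ - 1) η 0 x L ∧ SmallPlainRows r x L

section Identity

variable {A : Type*} [CommRing A]

open Classical in
-- Row 0 has no multiples, and its closed window imposes nothing beyond the crossing condition. So
-- the bit of row 1 is not tied to a bit below, and the sum splits according to its two values.
theorem sum_overRows_cons (q : A) {κ r η : ℕ} (hη : 0 < η) {R x : Finset ℕ} (hx : x ⊆ R)
    (hR : ∀ ρ ∈ R, 0 < ρ) (n e f : ℕ) (x' : Finset ℕ) :
    ∑ L ∈ rowLists κ R n, (if OverRows κ r η x ((e, f, x') :: L)
      then q ^ listWeight η 0 ((0, 0, x) :: (e, f, x') :: L) else 0) =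
    q ^ rowWeight η 0 (0, 0, x) * q ^ rowWeight η 1 (e, f, x') *
      ((if (x.card + (e + f) ≤ r ∧
            (x.card + (e + f) = r → e = 0 → crossing η x x' + (e + f) = κ)) ∧
          crossing η x x' + (e + f + 0) ≤ κ
        then overSum q κ r η R n 1 (f + 0) x' x.card else 0) +
       (if (x.card + (e + f) ≤ r ∧
            (x.card + (e + f) = r → e = 0 → crossing η x x' + (e + f) = κ)) ∧
          crossing η x x' + (e + f + 1) ≤ κ
        then overSum q κ r η R n 1 (f + 1) x' x.card else 0)) := by
  have push : ∀ (c : Prop) [Decidable c] (F : List Row → A), (if c then ∑ L ∈ rowLists κ R n, F L else 0) =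
      ∑ L ∈ rowLists κ R n, if c then F L else 0 := fun c _ F => by split_ifs <;> simp
  rw [← sum_windows_eq_overSum (t := 0) (ht := by omega),
    ← sum_windows_eq_overSum (t := 1) (ht := by omega), push, push, ← Finset.sum_add_distrib,
    Finset.mul_sum]
  refine Finset.sum_congr rfl fun L _ => ?_
  have hX := card_le_crossing_left hη (x := x) (x' := x') fun ρ h => hR ρ (hx h)
  have key : OverRows κ r η x ((e, f, x') :: L) ↔ (x.card + (e + f) ≤ r ∧
        (x.card + (e + f) = r → e = 0 → crossing η x x' + (e + f) = κ)) ∧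
      crossing η x x' + (e + f + tbit κ r 1 f x.card (overlines L)) ≤ κ ∧
      Windows κ r η 1 f x' x.card L := by
    rw [OverRows, Windows, SmallRows]
    simp only [zero_add]
    constructor
    · rintro ⟨⟨_, b, c⟩, d⟩
      exact ⟨d, b, c⟩
    · rintro ⟨d, b, c⟩
      refine ⟨⟨?_, b, c⟩, d⟩
      -- Only |x| + e + f = κ needs an argument. As |x| ≤ `crossing η x x'`, condition b then forces
      -- the bit of row 1 to vanish, and in this case the bits of rows 0 and 1 have the same parity.
      simp only [tbit, zero_add, one_mul] at b ⊢
      omega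
  have hτ : tbit κ r 1 f x.card (overlines L) = 0 ∨ tbit κ r 1 f x.card (overlines L) = 1 :=
    Nat.mod_two_eq_zero_or_one _
  rw [if_congr key rfl rfl, listWeight, listWeight, pow_add, pow_add, ← mul_assoc]
  rcases hτ with h | h <;> simp only [h, zero_ne_one, one_ne_zero, and_false, if_false, and_true,
    ite_self, zero_add, add_zero, mul_ite, mul_zero, ← ite_and, and_assoc]

open Classical in
theorem sum_plainRows_cons (q : A) {κ r η : ℕ} (hr : r ≤ κ) {R x : Finset ℕ}
    (n e f : ℕ) (x' : Finset ℕ) :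
    ∑ L ∈ rowLists κ R n, (if PlainRows κ r η x ((e, f, x') :: L)
      then q ^ listWeight η 0 ((0, 0, x) :: (e, f, x') :: L) else 0) =
    q ^ rowWeight η 0 (0, 0, x) * q ^ rowWeight η 1 (e, f, x') *
      (if e = 0 ∧ x.card + f + 1 ≤ r ∧ crossing η x x' + f ≤ κ - 1
        then plainSum q (κ - 1) κ η R n 1 f x' else 0) := by
  have push : ∀ (c : Prop) [Decidable c] (F : List Row → A), (if c then ∑ L ∈ rowLists κ R n, F L else 0) =
      ∑ L ∈ rowLists κ R n, if c then F L else 0 := fun c _ F => by split_ifs <;> simp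
  rw [← sum_plainWindows_eq_plainSum, push, Finset.mul_sum]
  refine Finset.sum_congr rfl fun L _ => ?_
  have key : PlainRows κ r η x ((e, f, x') :: L) ↔
      (e = 0 ∧ x.card + f + 1 ≤ r ∧ crossing η x x' + f ≤ κ - 1) ∧
      PlainWindows (κ - 1) η f x' L := by
    rw [PlainRows, PlainWindows, SmallPlainRows]
    constructor
    · rintro ⟨⟨a, b, c, d⟩, h⟩
      exact ⟨⟨a, h, c⟩, d⟩
    · rintro ⟨⟨a, h, c⟩, d⟩
      exact ⟨⟨a, by omega, c, d⟩, h⟩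
  rw [if_congr key rfl rfl, listWeight, listWeight, pow_add, pow_add, ← mul_assoc, ite_and]
  simp only [mul_ite, mul_zero]

open Classical in
/-- The identity for overpartitions and partitions with at most `n + 2` rows. -/
theorem sum_overRows_eq (q : A) {κ r η : ℕ} (hη : 0 < η) (hr : r ≤ κ) {R : Finset ℕ}
    (hRκ : R.card < κ) (hR : ∀ ρ ∈ R, 0 < ρ ∧ ρ < η) (n : ℕ) :
    ∑ x ∈ R.powerset, ∑ L ∈ rowLists κ R (n + 1),
      (if OverRows κ r η x L then q ^ listWeight η 0 ((0, 0, x) :: L) else 0) =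
    (∏ j ∈ Finset.range (n + 1), (1 + q ^ (η * (j + 1)))) *
      ∑ x ∈ R.powerset, ∑ L ∈ rowLists κ R (n + 1),
        (if PlainRows κ r η x L then q ^ listWeight η 0 ((0, 0, x) :: L) else 0) := by
  rw [Finset.mul_sum]
  refine Finset.sum_congr rfl fun x hx => ?_
  rw [Finset.mem_powerset] at hx
  rw [sum_rowLists_succ, sum_rowLists_succ, sum_rowSet, sum_rowSet, Finset.mul_sum]
  refine Finset.sum_congr rfl fun x' hx' => ?_
  rw [Finset.mem_powerset] at hx'
  have hC := crossing_le_card (η := η) hx hx'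
  have hX := card_le_crossing_left hη (x' := x') fun ρ h => (hR ρ (hx h)).1
  have hX' := card_le_crossing_right hη (x := x) fun ρ h => (hR ρ (hx' h)).2
  simp only [sum_overRows_cons q hη hx fun ρ h => (hR ρ h).1, sum_plainRows_cons q hr]
  obtain ⟨C, hCeq⟩ : ∃ C, κ = crossing η x x' + C := ⟨κ - crossing η x x', by omega⟩
  -- If row 0 alone has more than r parts, both sides are zero.
  rcases lt_or_ge r x.card with hrx | hrx
  · rw [Finset.mul_sum]
    refine Finset.sum_congr rfl fun g _ => ?_
    (repeat rw [if_neg (by omega)])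
    simp
  obtain ⟨y, hy⟩ := Nat.exists_eq_add_of_le hrx
  have step := sum_initial_step (κ := κ) (y := y) (C := C) (by omega) (by omega)
    (q ^ (η * (0 + 1))) fun h => overSum q κ r η R n 1 h x' x.card
  have step' := congrArg (q ^ rowWeight η 0 (0, 0, x) * q ^ rowWeight η 1 (0, 0, x') * ·) step
  simp only [Finset.mul_sum] at step'
  rw [Finset.mul_sum]
  refine Eq.trans (Finset.sum_congr rfl fun g _ => ?_)
    (step'.trans (Finset.sum_congr rfl fun g _ => ?_))
  · simp only [pow_rowWeight q η 1 _ g, mul_add, mul_ite, mul_zero, mul_assoc, zero_add]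
    congr 1 <;> congr 1 <;> refine if_congr ?_ rfl rfl <;>
      (try simp only [true_implies]) <;> omega
  · rw [if_neg (by simp : ¬ (1 = 0 ∧ _)), mul_zero, add_zero]
    simp only [pow_rowWeight q η 1 0 g, true_and, mul_ite, mul_zero, zero_add]
    refine ite_congr (propext (by omega)) (fun hc => ?_) fun _ => rfl
    rw [overSum_add_overSum q hη hRκ (fun ρ h => (hR ρ h).2) n 1 g hx' x.card (by omega),
      Finset.prod_range_succ']
    simp only [add_assoc, add_comm 1, zero_add]
    ring

end Identity

/-! ## Windows of sorted lists -/

section SortedLists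

variable {β : Type*} [LinearOrder β]

theorem List.Pairwise.eq_filter_append {l : List β} (hl : l.Pairwise (· ≥ ·)) {lo hi : β}
    (h : lo ≤ hi) :
    l = l.filter (hi < ·) ++ (l.filter (fun c => lo ≤ c ∧ c ≤ hi) ++ l.filter (· < lo)) := by
  induction l with
  | nil => rfl
  | cons a t ih =>
    rw [List.pairwise_cons] at hl
    have ih := ih hl.2
    rcases lt_or_ge hi a with h1 | h1
    · rw [List.filter_cons_of_pos (by simpa using h1),
        List.filter_cons_of_neg (by simp [h1]),
        List.filter_cons_of_neg (by simpa using h.trans h1.le), List.cons_append, ← ih]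
    · have e1 : t.filter (hi < ·) = [] := List.filter_eq_nil_iff.2 fun b hb => by
        simpa using (hl.1 b hb).trans h1
      rw [e1, List.nil_append] at ih
      rw [List.filter_cons_of_neg (p := (hi < ·)) (by simpa using h1), e1, List.nil_append]
      rcases le_or_gt lo a with h2 | h2
      · rw [List.filter_cons_of_pos (by simp [h1, h2]),
          List.filter_cons_of_neg (by simpa using h2), List.cons_append, ← ih]
      · have e2 : t.filter (fun c => lo ≤ c ∧ c ≤ hi) = [] :=
          List.filter_eq_nil_iff.2 fun b hb => by
            have := (show b ≤ a from hl.1 b hb).trans_lt h2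
            simp [this]
        rw [e2, List.nil_append] at ih
        rw [List.filter_cons_of_neg (by simp [h2]), e2, List.nil_append,
          List.filter_cons_of_pos (by simpa using h2), ← ih]

/-- In a sorted list the entries of an interval are contiguous. They start after the entries larger
than `hi`, and this start does not depend on j. -/
theorem exists_slice_eq_filter {l : List β} (hl : l.Pairwise (· ≥ ·)) {lo hi : β}
    (h : lo ≤ hi) : ∃ i, ∀ j,
      (l.drop i).take (l.filter (fun c => lo ≤ c ∧ c ≤ hi)).length =
        l.filter (fun c => lo ≤ c ∧ c ≤ hi) ∧
      (j < (l.filter (fun c => lo ≤ c ∧ c ≤ hi)).length →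
        l[i + j]? = (l.filter (fun c => lo ≤ c ∧ c ≤ hi))[j]?) := by
  have key := hl.eq_filter_append h
  generalize l.filter (fun c => lo ≤ c ∧ c ≤ hi) = w at *
  generalize l.filter (fun c => hi < c) = pre at *
  generalize l.filter (fun c => c < lo) = post at *
  subst key
  refine ⟨pre.length, fun j => ⟨by simp, fun hj => ?_⟩⟩
  rw [List.getElem?_append_right (by omega), Nat.add_sub_cancel_left,
    List.getElem?_append_left hj]

/-- Only a sublist, not an equality: entries equal to an end of the slice may lie outside it. -/
theorem slice_sublist_filter {l : List β} (hl : l.Pairwise (· ≥ ·)) {i m : ℕ} {a b : β}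
    (ha : l[i]? = some a) (hb : l[i + m]? = some b) :
    ((l.drop i).take (m + 1)).length = m + 1 ∧
      ((l.drop i).take (m + 1)).Sublist (l.filter (fun c => b ≤ c ∧ c ≤ a)) := by
  obtain ⟨hi, rfl⟩ := List.getElem?_eq_some_iff.1 ha
  obtain ⟨hj, rfl⟩ := List.getElem?_eq_some_iff.1 hb
  refine ⟨by rw [List.length_take, List.length_drop]; omega, ?_⟩
  have hs : ((l.drop i).take (m + 1)).Sublist l :=
    (List.take_sublist _ _).trans (List.drop_sublist _ _)
  have hf := hs.filter (fun c => decide (l[i + m] ≤ c ∧ c ≤ l[i]))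
  rwa [List.filter_eq_self.2] at hf
  intro c hc
  obtain ⟨n, hn, rfl⟩ := List.mem_iff_getElem.1 hc
  have hn' := hn
  rw [List.length_take, List.length_drop] at hn'
  rw [List.getElem_take, List.getElem_drop]
  have mono : ∀ s t (hs : s < l.length) (ht : t < l.length), s ≤ t → l[t] ≤ l[s] := by
    intro s t hs ht hst
    rcases hst.eq_or_lt with rfl | hst
    · exact le_rfl
    · exact List.pairwise_iff_getElem.1 hl s t hs ht hst
  simp only [decide_eq_true_eq]
  exact ⟨mono _ _ _ _ (by omega), mono _ _ _ _ (by omega)⟩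

/-- The part of a multiset in the interval from `lo` to `hi`. -/
def Multiset.between (s : Multiset β) (lo hi : β) : Multiset β :=
  s.filter fun c => lo ≤ c ∧ c ≤ hi

theorem Multiset.between_eq_coe_filter (s : Multiset β) (lo hi : β) :
    s.between lo hi = ((s.sort (· ≥ ·)).filter (fun c => lo ≤ c ∧ c ≤ hi) : List β) := by
  rw [Multiset.between, ← Multiset.filter_coe, Multiset.sort_eq]

theorem Multiset.card_between_eq_length (s : Multiset β) (lo hi : β) :
    (s.between lo hi).card = ((s.sort (· ≥ ·)).filter (fun c => lo ≤ c ∧ c ≤ hi)).length := by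
  rw [Multiset.between_eq_coe_filter, Multiset.coe_card]

/-- A window of a multiset that is not empty is a slice of the sorted list. -/
theorem exists_slice_eq_between (s : Multiset β) {lo hi : β} {m : ℕ}
    (h : m < (s.between lo hi).card) :
    ∃ i a b, (s.sort (· ≥ ·))[i]? = some a ∧ (s.sort (· ≥ ·))[i + m]? = some b ∧
      a ∈ s.between lo hi ∧ b ∈ s.between lo hi ∧ (∀ c ∈ s.between lo hi, c ≤ a) ∧
      ((s.between lo hi).card = m + 1 → (∀ c ∈ s.between lo hi, b ≤ c) ∧
        (((s.sort (· ≥ ·)).drop i).take (m + 1) : List β) = s.between lo hi) := by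
  have hle : lo ≤ hi := by
    obtain ⟨c, hc⟩ := Multiset.card_pos_iff_exists_mem.1 (by omega : 0 < (s.between lo hi).card)
    have := (Multiset.mem_filter.1 hc).2
    exact this.1.trans this.2
  have hs : (s.sort (· ≥ ·)).Pairwise (· ≥ ·) := Multiset.pairwise_sort _ _
  obtain ⟨i, hi'⟩ := exists_slice_eq_filter hs hle
  have hw := hs.sublist (List.filter_sublist (p := fun c => decide (lo ≤ c ∧ c ≤ hi)))
  rw [Multiset.between_eq_coe_filter] at *
  rw [Multiset.coe_card] at *
  generalize (s.sort (· ≥ ·)).filter (fun c => decide (lo ≤ c ∧ c ≤ hi)) = w at *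
  have h0 : w[0]? = some w[0] := List.getElem?_eq_getElem (by omega)
  have hm : w[m]? = some w[m] := List.getElem?_eq_getElem h
  refine ⟨i, w[0], w[m], ((hi' 0).2 (by omega)).trans h0, ((hi' m).2 h).trans hm,
    List.getElem_mem _, List.getElem_mem _, fun c hc => ?_, fun hc => ⟨fun c hc' => ?_, ?_⟩⟩
  · obtain ⟨n, hn, rfl⟩ := List.mem_iff_getElem.1 hc
    rcases Nat.eq_zero_or_pos n with rfl | hn0
    · exact le_rfl
    · exact List.pairwise_iff_getElem.1 hw 0 n (by omega) hn hn0
  · obtain ⟨n, hn, rfl⟩ := List.mem_iff_getElem.1 hc'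
    rcases (show n ≤ m by omega).eq_or_lt with rfl | hn0
    · exact le_rfl
    · exact List.pairwise_iff_getElem.1 hw n m hn (by omega) hn0
  · rw [← hc, (hi' 0).1]

/-- A slice of the sorted list lies in a window of the multiset. -/
theorem le_card_between (s : Multiset β) {i m : ℕ} {a b : β}
    (ha : (s.sort (· ≥ ·))[i]? = some a) (hb : (s.sort (· ≥ ·))[i + m]? = some b) :
    a ∈ s ∧ b ∈ s ∧ m + 1 ≤ (s.between b a).card ∧ ((s.between b a).card = m + 1 →
      (((s.sort (· ≥ ·)).drop i).take (m + 1) : List β) = s.between b a) := by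
  obtain ⟨h1, h2⟩ := slice_sublist_filter (Multiset.pairwise_sort _ _) ha hb
  refine ⟨(Multiset.mem_sort _).1 (List.mem_of_getElem? ha), (Multiset.mem_sort _).1
    (List.mem_of_getElem? hb), ?_, fun h => ?_⟩
  · rw [Multiset.card_between_eq_length]
    exact h1.symm.trans_le h2.length_le
  · rw [Multiset.card_between_eq_length] at h
    rw [Multiset.between_eq_coe_filter, h2.eq_of_length (h1.trans h.symm)]

end SortedLists

/-! ## Windows of overpartitions -/

namespace OverPart

/-- The position of a part in the order `1̄ < 1 < 2̄ < 2 < ⋯`. -/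
def code (a : OverPart) : ℕ := 2 * a.size + (ofLex a).2.toNat

theorem size_eq (a : OverPart) : a.size = a.code / 2 := by
  have := Bool.toNat_lt (ofLex a).2
  simp only [code]
  omega

theorem isOverlined_iff (a : OverPart) : a.IsOverlined ↔ a.code % 2 = 0 := by
  simp only [IsOverlined, code]
  cases (ofLex a).2 <;> simp

theorem le_iff (a b : OverPart) : a ≤ b ↔ a.code ≤ b.code := by
  rw [Prod.Lex.le_iff]
  simp only [code, size]
  cases (ofLex a).2 <;> cases (ofLex b).2 <;> simp <;> omega

theorem lt_iff (a b : OverPart) : a < b ↔ a.code < b.code := by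
  rw [← not_le, ← not_le, le_iff]

theorem code_injective : Function.Injective code := fun a b h =>
  le_antisymm ((le_iff a b).2 h.le) ((le_iff b a).2 h.ge)

theorem code_overlined (t : ℕ) : (overlined t).code = 2 * t := by simp [code, size, overlined]

theorem code_plain (t : ℕ) : (plain t).code = 2 * t + 1 := by simp [code, size, plain]

theorem code_shift (a : OverPart) (b : ℕ) : (a.shift b).code = a.code + 2 * b := by
  simp [code, size, shift]
  ring

theorem size_overlined (t : ℕ) : (overlined t).size = t := rfl

theorem size_plain (t : ℕ) : (plain t).size = t := rfl

theorem eq_overlined_or_eq_plain (a : OverPart) :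
    a = overlined a.size ∨ a = plain a.size := by
  have h := size_eq a
  rcases Nat.mod_two_eq_zero_or_one a.code with h' | h'
  · exact .inl (code_injective (by rw [code_overlined]; omega))
  · exact .inr (code_injective (by rw [code_plain]; omega))

end OverPart

theorem bandEnds_iff (η : ℕ) (a b : OverPart) : BandEnds η a b ↔
    a.code ≤ b.code + 2 * η ∧ (a.code % 2 = 0 → a.code < b.code + 2 * η) := by
  rw [BandEnds, OverPart.le_iff, OverPart.lt_iff, OverPart.isOverlined_iff, OverPart.code_shift]

theorem BandEnds.mono {η : ℕ} {a b hi lo : OverPart} (h : BandEnds η hi lo) (hb : lo ≤ b)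
    (ha : a ≤ hi) : BandEnds η a b := by
  rw [bandEnds_iff] at *
  rw [OverPart.le_iff] at hb ha
  omega

/-- This turns the gap condition into an upper bound for the number of parts in a window. -/
theorem gap_iff_not_bandEnds (η : ℕ) (a b : OverPart) :
    (b.shift η ≤ a ∧ (¬ a.IsOverlined → b.shift η < a)) ↔ ¬ BandEnds η a b := by
  rw [bandEnds_iff, OverPart.le_iff, OverPart.lt_iff, OverPart.isOverlined_iff,
    OverPart.code_shift]
  omega

/-- The number of overlined parts not exceeding `N` that are not divisible by `η`. -/
def lowNonmultiples (η : ℕ) (μ : Multiset OverPart) (N : OverPart) : ℕ :=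
  μ.countP fun a => a.IsOverlined ∧ a ≤ N ∧ ¬ η ∣ a.size

/-- The number of overlined parts greater than or equal to `N` that are divisible by `η`. -/
def highMultiples (η : ℕ) (μ : Multiset OverPart) (N : OverPart) : ℕ :=
  μ.countP fun a => a.IsOverlined ∧ N ≤ a ∧ η ∣ a.size

/-- The parity condition for the window from `lo` to `hi`. -/
def WindowParity (η r : ℕ) (μ : Multiset OverPart) (lo hi : OverPart) : Prop :=
  (((μ.between lo hi).map fun c => c.size / η).sum + r + 1 + lowNonmultiples η μ hi +
    highMultiples η μ lo) % 2 = 0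

/-- A common part d separates the cases. Every part at most d is below both upper ends, and for a
part at least d, being below an upper end is the same as lying in the window. So the count of low
non-multiples depends only on the contents of the window, and dually for the high multiples. -/
theorem windowParity_congr {η r : ℕ} {μ : Multiset OverPart} {lo hi lo' hi' : OverPart}
    (h : μ.between lo hi = μ.between lo' hi') (h0 : μ.between lo hi ≠ 0) :
    WindowParity η r μ lo hi ↔ WindowParity η r μ lo' hi' := by
  obtain ⟨d, hd⟩ := Multiset.exists_mem_of_ne_zero h0
  have mem : ∀ c ∈ μ, (lo ≤ c ∧ c ≤ hi ↔ lo' ≤ c ∧ c ≤ hi') := fun c hc => by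
    have := congrArg (c ∈ ·) h
    simpa [Multiset.between, hc] using this
  have hd' := (Multiset.mem_filter.1 hd)
  have hd2 := (mem d hd'.1).1 hd'.2
  have h1 : lowNonmultiples η μ hi = lowNonmultiples η μ hi' := by
    refine Multiset.countP_congr rfl fun c hc => ?_
    have := mem c hc
    have e : c ≤ hi ↔ c ≤ hi' := by
      rcases le_total c d with g | g
      · exact ⟨fun _ => g.trans hd2.2, fun _ => g.trans hd'.2.2⟩
      · exact ⟨fun h => (this.1 ⟨hd'.2.1.trans g, h⟩).2,
          fun h => (this.2 ⟨hd2.1.trans g, h⟩).2⟩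
    rw [e]
  have h2 : highMultiples η μ lo = highMultiples η μ lo' := by
    refine Multiset.countP_congr rfl fun c hc => ?_
    have := mem c hc
    have e : lo ≤ c ↔ lo' ≤ c := by
      rcases le_total d c with g | g
      · exact ⟨fun _ => hd2.1.trans g, fun _ => hd'.2.1.trans g⟩
      · exact ⟨fun h => (this.1 ⟨h, g.trans hd'.2.2⟩).1,
          fun h => (this.2 ⟨h, g.trans hd2.2⟩).1⟩
    rw [e]
  rw [WindowParity, WindowParity, h, h1, h2]

theorem modEq_iff_windowParity {η r n : ℕ} (π : Overpartition n) {l : List OverPart}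
    {lo hi : OverPart} (h : (l : Multiset OverPart) = π.parts.between lo hi) :
    ((((l.map (fun c => c.size / η)).sum : ℕ) : ℤ)
      ≡ (r : ℤ) - 1 + π.V η hi + π.O η lo [ZMOD 2]) ↔ WindowParity η r π.parts lo hi := by
  rw [WindowParity, ← h, Multiset.map_coe, Multiset.sum_coe, Int.ModEq]
  change _ ↔ (_ + r + 1 + π.V η hi + π.O η lo) % 2 = 0
  omega

section Gap

/-- No window has more than `κ` parts. -/
theorem gap_iff_card_between_le {η κ : ℕ} (μ : Multiset OverPart) :
    (∀ i a b, (μ.sort (· ≥ ·))[i]? = some a → (μ.sort (· ≥ ·))[i + κ]? = some b →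
      b.shift η ≤ a ∧ (¬ a.IsOverlined → b.shift η < a)) ↔
    ∀ lo ∈ μ, ∀ hi ∈ μ, BandEnds η hi lo → (μ.between lo hi).card ≤ κ := by
  simp only [gap_iff_not_bandEnds]
  constructor
  · intro h lo _ hi _ hband
    by_contra! hc
    obtain ⟨i, a, b, ha, hb, ha', hb', -⟩ := exists_slice_eq_between μ hc
    rw [Multiset.between, Multiset.mem_filter] at ha' hb'
    exact h i a b ha hb (hband.mono hb'.2.1 ha'.2.2)
  · intro h i a b ha hb hband
    obtain ⟨ha', hb', hc, -⟩ := le_card_between μ ha hb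
    have := h b hb' a ha' hband
    omega

/-- The windows with ends in the multiset determine all windows. -/
theorem card_between_le {η κ : ℕ} {μ : Multiset OverPart}
    (h : ∀ lo ∈ μ, ∀ hi ∈ μ, BandEnds η hi lo → (μ.between lo hi).card ≤ κ)
    {lo hi : OverPart} (hband : BandEnds η hi lo) : (μ.between lo hi).card ≤ κ := by
  by_contra! hc
  obtain ⟨m, hm⟩ : ∃ m, (μ.between lo hi).card = m + 1 :=
    ⟨(μ.between lo hi).card - 1, by omega⟩
  obtain ⟨i, a, b, ha, hb, ha', hb', hmax, hmin⟩ :=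
    exists_slice_eq_between μ (lo := lo) (hi := hi) (m := m) (by omega)
  obtain ⟨ha2, hb2, hc2, -⟩ := le_card_between μ ha hb
  rw [Multiset.between, Multiset.mem_filter] at ha' hb'
  have := h b hb2 a ha2 (hband.mono hb'.2.1 ha'.2.2)
  omega

/-- A slice of κ consecutive parts might omit parts equal to its ends. The bound h excludes this, so
the slice is the whole window between its ends. -/
theorem parity_iff_windowParity {η κ r n : ℕ} (hκ : 0 < κ) (π : Overpartition n)
    (h : ∀ lo ∈ π.parts, ∀ hi ∈ π.parts, BandEnds η hi lo →
      (π.parts.between lo hi).card ≤ κ) :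
    (∀ i a b, π.seq[i]? = some a → π.seq[i + (κ - 1)]? = some b → BandEnds η a b →
      ((((π.seq.drop i).take κ).map (fun c => c.size / η)).sum : ℤ)
        ≡ (r : ℤ) - 1 + π.V η a + π.O η b [ZMOD 2]) ↔
    ∀ lo ∈ π.parts, ∀ hi ∈ π.parts, BandEnds η hi lo → (π.parts.between lo hi).card = κ →
      WindowParity η r π.parts lo hi := by
  obtain ⟨m, rfl⟩ : ∃ m, κ = m + 1 := ⟨κ - 1, by omega⟩
  rw [Nat.add_sub_cancel]
  constructor
  · intro hp lo _ hi _ hband hc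
    obtain ⟨i, a, b, ha, hb, ha', hb', hmax, hmin⟩ :=
      exists_slice_eq_between π.parts (lo := lo) (hi := hi) (m := m) (by omega)
    obtain ⟨hmin, hs⟩ := hmin hc
    have ha2 := ha'
    have hb2 := hb'
    rw [Multiset.between, Multiset.mem_filter] at ha2 hb2
    have hband' := hband.mono hb2.2.1 ha2.2.2
    have e : π.parts.between lo hi = π.parts.between b a := by
      refine Multiset.filter_congr fun c hc => ⟨fun h => ?_, fun h => ?_⟩
      · have hmem : c ∈ π.parts.between lo hi := Multiset.mem_filter.2 ⟨hc, h⟩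
        exact ⟨hmin c hmem, hmax c hmem⟩
      · exact ⟨hb2.2.1.trans h.1, h.2.trans ha2.2.2⟩
    rw [windowParity_congr e (by rw [Ne, ← Multiset.card_eq_zero]; omega)]
    exact (modEq_iff_windowParity π (hs.trans e)).1 (hp i a b ha hb hband')
  · intro hp i a b ha hb hband
    obtain ⟨ha', hb', hc, hs⟩ := le_card_between π.parts ha hb
    have hc' := h b hb' a ha' hband
    exact (modEq_iff_windowParity π (hs (by omega))).2 (hp b hb' a ha' hband (by omega))

/-- The ends of a standard window need not be parts. Shrinking it to its largest and smallest part
changes neither the contents nor the parity condition. -/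
theorem windowParity_of_mem {η κ r : ℕ} (hκ : 0 < κ) {μ : Multiset OverPart}
    (h : ∀ lo ∈ μ, ∀ hi ∈ μ, BandEnds η hi lo → (μ.between lo hi).card = κ →
      WindowParity η r μ lo hi) {lo hi : OverPart} (hband : BandEnds η hi lo)
    (hc : (μ.between lo hi).card = κ) : WindowParity η r μ lo hi := by
  obtain ⟨m, rfl⟩ : ∃ m, κ = m + 1 := ⟨κ - 1, by omega⟩
  obtain ⟨i, a, b, ha, hb, ha', hb', hmax, hmin⟩ :=
    exists_slice_eq_between μ (lo := lo) (hi := hi) (m := m) (by omega)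
  obtain ⟨hmin, -⟩ := hmin hc
  rw [Multiset.between, Multiset.mem_filter] at ha' hb'
  have e : μ.between lo hi = μ.between b a := by
    refine Multiset.filter_congr fun c hc => ⟨fun h => ?_, fun h => ?_⟩
    · have hmem : c ∈ μ.between lo hi := Multiset.mem_filter.2 ⟨hc, h⟩
      exact ⟨hmin c hmem, hmax c hmem⟩
    · exact ⟨hb'.2.1.trans h.1, h.2.trans ha'.2.2⟩
  rw [windowParity_congr e (by rw [Ne, ← Multiset.card_eq_zero]; omega)]
  exact h b hb'.1 a ha'.1 (hband.mono hb'.2.1 ha'.2.2) (by rw [← e, hc])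

/-- A full window with ends among the parts, taken from the sorted list. -/
theorem exists_window_of_slice {η κ : ℕ} (hκ : 0 < κ) {μ : Multiset OverPart}
    (h : ∀ lo ∈ μ, ∀ hi ∈ μ, BandEnds η hi lo → (μ.between lo hi).card ≤ κ) {N : OverPart}
    (hs : ∃ i a b, (μ.sort (· ≥ ·))[i]? = some a ∧ (μ.sort (· ≥ ·))[i + (κ - 1)]? = some b ∧
      a < N ∧ BandEnds η a b) :
    ∃ lo ∈ μ, ∃ hi ∈ μ, hi < N ∧ BandEnds η hi lo ∧ (μ.between lo hi).card = κ := by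
  obtain ⟨i, a, b, ha, hb, hN, hband⟩ := hs
  obtain ⟨ha', hb', hc, -⟩ := le_card_between μ ha hb
  have := h b hb' a ha' hband
  exact ⟨b, hb', a, ha', hN, hband, by omega⟩

/-- A full window contains a slice of the sorted list. -/
theorem exists_slice_of_window {η κ : ℕ} (hκ : 0 < κ) {μ : Multiset OverPart} {lo hi N : OverPart}
    (hN : hi < N) (hband : BandEnds η hi lo) (hc : (μ.between lo hi).card = κ) :
    ∃ i a b, (μ.sort (· ≥ ·))[i]? = some a ∧ (μ.sort (· ≥ ·))[i + (κ - 1)]? = some b ∧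
      a < N ∧ BandEnds η a b := by
  obtain ⟨i, a, b, ha, hb, ha', hb', -⟩ :=
    exists_slice_eq_between μ (lo := lo) (hi := hi) (m := κ - 1) (by omega)
  rw [Multiset.between, Multiset.mem_filter] at ha' hb'
  exact ⟨i, a, b, ha, hb, ha'.2.2.trans_lt hN, hband.mono hb'.2.1 ha'.2.2⟩

end Gap

/-! ## From rows to multisets of parts -/

/-- The parts in row `j`. -/
def rowParts (η j : ℕ) (p : Row) : Multiset OverPart :=
  Multiset.replicate p.1 (OverPart.overlined (η * j)) +
    Multiset.replicate p.2.1 (OverPart.plain (η * j)) +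
    p.2.2.val.map fun ρ => OverPart.overlined (η * j + ρ)

/-- The parts in the rows `j, j + 1, …`. -/
def partsFrom (η : ℕ) : ℕ → List Row → Multiset OverPart
  | _, [] => 0
  | j, p :: L => rowParts η j p + partsFrom η (j + 1) L

/-- The row `j` of a list of rows, empty beyond the end of the list. -/
def rowAt (L : List Row) (j : ℕ) : Row := L.getD j (0, 0, ∅)

/-- The number of parts not divisible by `η` in a list of rows. -/
def nonmultiples (L : List Row) : ℕ := (L.map fun p => p.2.2.card).sum

/-- At most one overlined multiple of `η`, and residues between `0` and `η`. -/
def IsRow (η : ℕ) (p : Row) : Prop := p.1 ≤ 1 ∧ ∀ ρ ∈ p.2.2, 0 < ρ ∧ ρ < η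

theorem isRow_rowAt {η : ℕ} {L : List Row} (h : ∀ p ∈ L, IsRow η p) (j : ℕ) :
    IsRow η (rowAt L j) := by
  rw [rowAt, List.getD_eq_getElem?_getD]
  cases hj : L[j]? with
  | none => simp [IsRow]
  | some p => exact h p (List.mem_of_getElem? hj)

theorem mem_rowParts {η j : ℕ} {p : Row} {a : OverPart} :
    a ∈ rowParts η j p ↔ (p.1 ≠ 0 ∧ a = OverPart.overlined (η * j)) ∨
      (p.2.1 ≠ 0 ∧ a = OverPart.plain (η * j)) ∨
      ∃ ρ ∈ p.2.2, a = OverPart.overlined (η * j + ρ) := by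
  simp only [rowParts, Multiset.mem_add, Multiset.mem_replicate, Multiset.mem_map, Finset.mem_val,
    or_assoc, eq_comm]

theorem size_mem_rowParts {η j : ℕ} (hη : 0 < η) {p : Row} (hp : IsRow η p) {a : OverPart}
    (ha : a ∈ rowParts η j p) : η * j ≤ a.size ∧ a.size < η * (j + 1) := by
  rw [mul_add, mul_one]
  rcases mem_rowParts.1 ha with ⟨-, rfl⟩ | ⟨-, rfl⟩ | ⟨ρ, hρ, rfl⟩
  · rw [OverPart.size_overlined]; omega
  · rw [OverPart.size_plain]; omega
  · have := hp.2 ρ hρ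
    rw [OverPart.size_overlined]; omega

theorem size_mem_partsFrom {η m : ℕ} (hη : 0 < η) {L : List Row} (hL : ∀ p ∈ L, IsRow η p)
    {a : OverPart} (ha : a ∈ partsFrom η m L) :
    η * m ≤ a.size ∧ a.size < η * (m + L.length) := by
  induction L generalizing m with
  | nil => simp [partsFrom] at ha
  | cons p L ih =>
    rw [partsFrom, Multiset.mem_add] at ha
    rw [List.forall_mem_cons] at hL
    rw [List.length_cons]
    rcases ha with ha | ha
    · obtain ⟨h1, h2⟩ := size_mem_rowParts hη hL.1 ha
      exact ⟨h1, h2.trans_le (Nat.mul_le_mul_left _ (by omega))⟩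
    · obtain ⟨h1, h2⟩ := ih hL.2 ha
      exact ⟨(Nat.mul_le_mul_left _ (by omega)).trans h1,
        h2.trans_le (Nat.mul_le_mul_left _ (by omega))⟩

theorem partsFrom_eq_add (η m j : ℕ) (L : List Row) :
    partsFrom η m L = partsFrom η m (L.take j) + rowParts η (m + j) (rowAt L j) +
      partsFrom η (m + j + 1) (L.drop (j + 1)) := by
  induction L generalizing m j with
  | nil => simp [partsFrom, rowAt, rowParts]
  | cons p L ih =>
    cases j with
    | zero => simp [partsFrom, rowAt]
    | succ j =>
      rw [partsFrom, ih (m + 1) j, List.take_succ_cons, partsFrom, List.drop_succ_cons]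
      simp only [rowAt, List.getD_cons_succ, add_assoc, add_comm 1 j]

theorem partsFrom_eq_add_add (η m j : ℕ) (L : List Row) :
    partsFrom η m L = partsFrom η m (L.take j) + rowParts η (m + j) (rowAt L j) +
      rowParts η (m + j + 1) (rowAt L (j + 1)) +
      partsFrom η (m + j + 2) (L.drop (j + 2)) := by
  rw [partsFrom_eq_add η m j, partsFrom_eq_add η (m + j + 1) 0 (L.drop (j + 1))]
  simp [partsFrom, rowAt, add_assoc]

theorem exists_mem_rowParts {η m : ℕ} {L : List Row} {a : OverPart} (ha : a ∈ partsFrom η m L) :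
    ∃ j < L.length, a ∈ rowParts η (m + j) (rowAt L j) := by
  induction L generalizing m with
  | nil => simp [partsFrom] at ha
  | cons p L ih =>
    rw [partsFrom, Multiset.mem_add] at ha
    rcases ha with ha | ha
    · exact ⟨0, by simp, by simpa [rowAt] using ha⟩
    · obtain ⟨j, hj, h⟩ := ih ha
      exact ⟨j + 1, by simpa using hj, by
        simpa [rowAt, add_assoc, add_comm 1 j] using h⟩

theorem between_add {β : Type*} [LinearOrder β] (s t : Multiset β) (lo hi : β) :
    (s + t).between lo hi = s.between lo hi + t.between lo hi := Multiset.filter_add _ _ _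

theorem between_eq_self {s : Multiset OverPart} {lo hi : OverPart}
    (h : ∀ a ∈ s, lo.code ≤ a.code ∧ a.code ≤ hi.code) : s.between lo hi = s :=
  Multiset.filter_eq_self.2 fun a ha => by
    rw [OverPart.le_iff, OverPart.le_iff]
    exact h a ha

theorem between_eq_zero {s : Multiset OverPart} {lo hi : OverPart}
    (h : ∀ a ∈ s, a.code < lo.code ∨ hi.code < a.code) : s.between lo hi = 0 :=
  Multiset.filter_eq_nil.2 fun a ha => by
    rw [OverPart.le_iff, OverPart.le_iff]
    have := h a ha
    omega

theorem between_map (x : Finset ℕ) (b : ℕ) (lo hi : OverPart) :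
    (x.val.map fun ρ => OverPart.overlined (b + ρ)).between lo hi =
      (x.filter fun ρ => lo.code ≤ 2 * (b + ρ) ∧ 2 * (b + ρ) ≤ hi.code).val.map
        fun ρ => OverPart.overlined (b + ρ) := by
  rw [Multiset.between, Multiset.filter_map, Finset.filter_val]
  simp only [Function.comp_def, OverPart.le_iff, OverPart.code_overlined]

theorem code_mem_partsFrom {η m : ℕ} (hη : 0 < η) {L : List Row} (hL : ∀ p ∈ L, IsRow η p)
    {a : OverPart} (ha : a ∈ partsFrom η m L) :
    2 * (η * m) ≤ a.code ∧ a.code < 2 * (η * (m + L.length)) := by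
  have := size_mem_partsFrom hη hL ha
  rw [OverPart.size_eq] at this
  omega

theorem code_mem_partsFrom_take {η : ℕ} (hη : 0 < η) {L : List Row} (hL : ∀ p ∈ L, IsRow η p)
    {j : ℕ} {a : OverPart} (ha : a ∈ partsFrom η 0 (L.take j)) : a.code < 2 * (η * j) := by
  have h := (code_mem_partsFrom hη (fun p hp => hL p (List.mem_of_mem_take hp)) ha).2
  have h2 : η * (0 + (L.take j).length) ≤ η * j :=
    Nat.mul_le_mul_left _ (by rw [List.length_take]; omega)
  omega

theorem code_mem_partsFrom_drop {η m : ℕ} (hη : 0 < η) {L : List Row} (hL : ∀ p ∈ L, IsRow η p)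
    {j : ℕ} {a : OverPart} (ha : a ∈ partsFrom η m (L.drop j)) : 2 * (η * m) ≤ a.code :=
  (code_mem_partsFrom hη (fun p hp => hL p (List.mem_of_mem_drop hp)) ha).1

/-- The overlined jη lies just below the lower end and is left out, while both kinds of (j + 1)η are
included. The non-multiples of row j + 1 lie above the upper end. -/
theorem between_closed {η : ℕ} (hη : 0 < η) {L : List Row} (hL : ∀ p ∈ L, IsRow η p) (j : ℕ) :
    (partsFrom η 0 L).between (OverPart.plain (η * j)) (OverPart.plain (η * (j + 1))) =
      Multiset.replicate (rowAt L j).2.1 (OverPart.plain (η * j)) +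
      (rowAt L j).2.2.val.map (fun ρ => OverPart.overlined (η * j + ρ)) +
      (Multiset.replicate (rowAt L (j + 1)).1 (OverPart.overlined (η * (j + 1))) +
      Multiset.replicate (rowAt L (j + 1)).2.1 (OverPart.plain (η * (j + 1)))) := by
  have h1 : η * (j + 1) = η * j + η := by ring
  have h2 : η * (j + 2) = η * j + 2 * η := by ring
  have hp := isRow_rowAt hL j
  have hp' := isRow_rowAt hL (j + 1)
  rw [partsFrom_eq_add_add η 0 j]
  simp only [zero_add, between_add, rowParts]
  rw [between_eq_zero (s := partsFrom η 0 _), between_eq_zero (s := partsFrom η _ _),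
    between_eq_zero (s := Multiset.replicate (rowAt L j).1 _),
    between_eq_self (s := Multiset.replicate (rowAt L j).2.1 _),
    between_eq_self (s := Multiset.map _ (rowAt L j).2.2.val),
    between_eq_self (s := Multiset.replicate (rowAt L (j + 1)).1 _),
    between_eq_self (s := Multiset.replicate (rowAt L (j + 1)).2.1 _),
    between_eq_zero (s := Multiset.map _ (rowAt L (j + 1)).2.2.val)]
  · simp only [zero_add, add_zero]
  all_goals intro a ha
  · obtain ⟨ρ, hρ, rfl⟩ := Multiset.mem_map.1 ha
    have := hp'.2 ρ hρ
    simp only [OverPart.code_plain, OverPart.code_overlined]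
    omega
  · rw [Multiset.eq_of_mem_replicate ha]
    simp only [OverPart.code_plain]
    omega
  · rw [Multiset.eq_of_mem_replicate ha]
    simp only [OverPart.code_plain, OverPart.code_overlined]
    omega
  · obtain ⟨ρ, hρ, rfl⟩ := Multiset.mem_map.1 ha
    have := hp.2 ρ hρ
    simp only [OverPart.code_plain, OverPart.code_overlined]
    omega
  · rw [Multiset.eq_of_mem_replicate ha]
    simp only [OverPart.code_plain]
    omega
  · rw [Multiset.eq_of_mem_replicate ha]
    simp only [OverPart.code_plain, OverPart.code_overlined]
    omega
  · have := code_mem_partsFrom_drop hη hL ha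
    simp only [OverPart.code_plain]
    omega
  · have := code_mem_partsFrom_take hη hL ha
    simp only [OverPart.code_plain]
    omega

theorem between_crossing {η : ℕ} (hη : 0 < η) {L : List Row} (hL : ∀ p ∈ L, IsRow η p) (j : ℕ)
    {ρ : ℕ} (hρ : ρ < η) :
    (partsFrom η 0 L).between (OverPart.overlined (η * j + ρ + 1))
        (OverPart.plain (η * (j + 1) + ρ)) =
      ((rowAt L j).2.2.filter (ρ < ·)).val.map (fun σ => OverPart.overlined (η * j + σ)) +
      (Multiset.replicate (rowAt L (j + 1)).1 (OverPart.overlined (η * (j + 1))) +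
      Multiset.replicate (rowAt L (j + 1)).2.1 (OverPart.plain (η * (j + 1))) +
      ((rowAt L (j + 1)).2.2.filter (· ≤ ρ)).val.map
        (fun σ => OverPart.overlined (η * (j + 1) + σ))) := by
  have h1 : η * (j + 1) = η * j + η := by ring
  have h2 : η * (j + 2) = η * j + 2 * η := by ring
  have hp := isRow_rowAt hL j
  have hp' := isRow_rowAt hL (j + 1)
  rw [partsFrom_eq_add_add η 0 j]
  simp only [zero_add, between_add, rowParts, between_map]
  rw [between_eq_zero (s := partsFrom η 0 _), between_eq_zero (s := partsFrom η _ _),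
    between_eq_zero (s := Multiset.replicate (rowAt L j).1 _),
    between_eq_zero (s := Multiset.replicate (rowAt L j).2.1 _),
    between_eq_self (s := Multiset.replicate (rowAt L (j + 1)).1 _),
    between_eq_self (s := Multiset.replicate (rowAt L (j + 1)).2.1 _)]
  · simp only [zero_add, add_zero]
    refine congrArg₂ (· + ·) ?_ (congrArg₂ (· + ·) rfl ?_)
    · refine congrArg (fun x : Finset ℕ => x.val.map _) (Finset.filter_congr fun σ hσ => ?_)
      have := hp.2 σ hσ
      simp only [OverPart.code_plain, OverPart.code_overlined]
      omega
    · refine congrArg (fun x : Finset ℕ => x.val.map _) (Finset.filter_congr fun σ hσ => ?_)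
      have := hp'.2 σ hσ
      simp only [OverPart.code_plain, OverPart.code_overlined]
      omega
  all_goals intro a ha
  · rw [Multiset.eq_of_mem_replicate ha]
    simp only [OverPart.code_plain, OverPart.code_overlined]
    omega
  · rw [Multiset.eq_of_mem_replicate ha]
    simp only [OverPart.code_plain, OverPart.code_overlined]
    omega
  · rw [Multiset.eq_of_mem_replicate ha]
    simp only [OverPart.code_plain, OverPart.code_overlined]
    omega
  · rw [Multiset.eq_of_mem_replicate ha]
    simp only [OverPart.code_plain, OverPart.code_overlined]
    omega
  · have := code_mem_partsFrom_drop hη hL ha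
    simp only [OverPart.code_plain]
    omega
  · have := code_mem_partsFrom_take hη hL ha
    simp only [OverPart.code_overlined]
    omega

theorem countP_replicate_eq {β : Type*} (p : β → Prop) [DecidablePred p] (n : ℕ) (a : β) :
    (Multiset.replicate n a).countP p = if p a then n else 0 := by
  split_ifs with h
  · exact ((Multiset.countP_eq_card (p := p)).2 fun b hb => Multiset.eq_of_mem_replicate hb ▸ h).trans
      (Multiset.card_replicate _ _)
  · exact (Multiset.countP_eq_zero (p := p)).2 fun b hb => Multiset.eq_of_mem_replicate hb ▸ h

theorem countP_rowParts (p : OverPart → Prop) [DecidablePred p] (η j : ℕ) (P : Row) :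
    (rowParts η j P).countP p = (if p (OverPart.overlined (η * j)) then P.1 else 0) +
      (if p (OverPart.plain (η * j)) then P.2.1 else 0) +
      (P.2.2.filter fun ρ => p (OverPart.overlined (η * j + ρ))).card := by
  rw [rowParts, Multiset.countP_add, Multiset.countP_add, countP_replicate_eq,
    countP_replicate_eq, Multiset.countP_map]
  rfl

theorem not_dvd_row {η j ρ : ℕ} (h : 0 < ρ ∧ ρ < η) : ¬ η ∣ η * j + ρ := by
  rw [Nat.dvd_add_right (dvd_mul_right _ _)]
  exact fun h' => absurd (Nat.le_of_dvd h.1 h') (by omega)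

theorem isOverlined_overlined (t : ℕ) : (OverPart.overlined t).IsOverlined := rfl

theorem not_isOverlined_plain (t : ℕ) : ¬ (OverPart.plain t).IsOverlined := by
  simp [OverPart.IsOverlined, OverPart.plain]

theorem countP_nonmultiples {η : ℕ} (m : ℕ) {L : List Row} (hL : ∀ p ∈ L, IsRow η p) :
    (partsFrom η m L).countP (fun a => a.IsOverlined ∧ ¬ η ∣ a.size) = nonmultiples L := by
  induction L generalizing m with
  | nil => rfl
  | cons p L ih =>
    rw [List.forall_mem_cons] at hL
    rw [partsFrom, Multiset.countP_add, ih _ hL.2, countP_rowParts,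
      if_neg (by simp [OverPart.size_overlined]), if_neg (by simp [not_isOverlined_plain]),
      Finset.filter_true_of_mem fun ρ hρ => ⟨isOverlined_overlined _, not_dvd_row (hL.1.2 ρ hρ)⟩]
    simp [nonmultiples]

theorem countP_overlines {η : ℕ} (m : ℕ) {L : List Row} (hL : ∀ p ∈ L, IsRow η p) :
    (partsFrom η m L).countP (fun a => a.IsOverlined ∧ η ∣ a.size) = overlines L := by
  induction L generalizing m with
  | nil => rfl
  | cons p L ih =>
    rw [List.forall_mem_cons] at hL
    rw [partsFrom, Multiset.countP_add, ih _ hL.2, countP_rowParts,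
      if_pos (by simp [OverPart.size_overlined, isOverlined_overlined]),
      if_neg (by simp [not_isOverlined_plain]),
      Finset.filter_false_of_mem fun ρ hρ h => not_dvd_row (hL.1.2 ρ hρ) h.2]
    simp [overlines]

theorem nonmultiples_take_succ (L : List Row) (j : ℕ) :
    nonmultiples (L.take (j + 1)) = nonmultiples (L.take j) + (rowAt L j).2.2.card := by
  induction L generalizing j with
  | nil => simp [nonmultiples, rowAt]
  | cons p L ih =>
    cases j with
    | zero => simp [nonmultiples, rowAt]
    | succ j =>
      have := ih j
      simp only [nonmultiples, rowAt, List.take_succ_cons, List.map_cons, List.sum_cons,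
        List.getD_cons_succ] at this ⊢
      omega

theorem overlines_drop (L : List Row) (j : ℕ) :
    overlines (L.drop j) = (rowAt L j).1 + overlines (L.drop (j + 1)) := by
  induction L generalizing j with
  | nil => simp [overlines, rowAt]
  | cons p L ih =>
    cases j with
    | zero => simp [overlines, rowAt]
    | succ j => simpa [rowAt] using ih j

/-- The non-multiples not exceeding a part in row `j + 1`. -/
theorem lowNonmultiples_eq {η : ℕ} (hη : 0 < η) {L : List Row} (hL : ∀ p ∈ L, IsRow η p) (j : ℕ)
    {ρ : ℕ} (hρ : ρ < η) :
    lowNonmultiples η (partsFrom η 0 L) (OverPart.plain (η * (j + 1) + ρ)) =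
      nonmultiples (L.take (j + 1)) + ((rowAt L (j + 1)).2.2.filter (· ≤ ρ)).card := by
  have h1 : η * (j + 1 + 1) = η * (j + 1) + η := by ring
  have hp' := isRow_rowAt hL (j + 1)
  rw [lowNonmultiples, partsFrom_eq_add η 0 (j + 1), Multiset.countP_add, Multiset.countP_add,
    countP_rowParts, zero_add, if_neg (by simp [OverPart.size_overlined]),
    if_neg (by simp [not_isOverlined_plain]), zero_add, zero_add]
  refine (congrArg₂ (· + ·) ?_ (Multiset.countP_eq_zero.2 ?_)).trans (add_zero _)
  · congr 1
    · rw [← countP_nonmultiples 0 fun p hp => hL p (List.mem_of_mem_take hp)]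
      refine Multiset.countP_congr rfl fun a ha => ?_
      have := code_mem_partsFrom_take hη hL ha
      rw [OverPart.le_iff, OverPart.code_plain]
      refine propext ⟨fun h => ⟨h.1, h.2.2⟩, fun h => ⟨h.1, by omega, h.2⟩⟩
    · congr 1
      refine Finset.filter_congr fun σ hσ => ?_
      have h := not_dvd_row (j := j + 1) (hp'.2 σ hσ)
      rw [OverPart.le_iff, OverPart.code_plain, OverPart.code_overlined]
      simp only [isOverlined_overlined, OverPart.size_overlined, h, true_and, not_false_eq_true,
        and_true]
      omega
  · intro a ha h
    have := code_mem_partsFrom_drop hη hL ha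
    rw [OverPart.le_iff, OverPart.code_plain] at h
    omega

/-- The overlined multiples of `η` that are at least as large as a part in row `j`. -/
theorem highMultiples_eq {η : ℕ} (hη : 0 < η) {L : List Row} (hL : ∀ p ∈ L, IsRow η p) (j : ℕ)
    {N : OverPart} (hN : 2 * (η * j) < N.code) (hN' : N.code ≤ 2 * (η * (j + 1))) :
    highMultiples η (partsFrom η 0 L) N = overlines (L.drop (j + 1)) := by
  have hp := isRow_rowAt hL j
  rw [highMultiples, partsFrom_eq_add η 0 j, Multiset.countP_add, Multiset.countP_add,
    countP_rowParts, zero_add, if_neg (by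
      rw [OverPart.le_iff, OverPart.code_overlined]; omega),
    if_neg (by simp [not_isOverlined_plain]), zero_add,
    Finset.filter_false_of_mem fun ρ hρ h => not_dvd_row (hp.2 ρ hρ) h.2.2,
    Finset.card_empty, add_zero,
    ← countP_overlines (j + 1) fun p hp => hL p (List.mem_of_mem_drop hp)]
  refine (congrArg₂ (· + ·) (Multiset.countP_eq_zero.2 ?_) ?_).trans (zero_add _)
  rotate_left
  · refine Multiset.countP_congr rfl fun a ha => ?_
    have := code_mem_partsFrom_drop hη hL ha
    rw [OverPart.le_iff]
    refine propext ⟨fun h => ⟨h.1, h.2.2⟩, fun h => ⟨h.1, by omega, h.2⟩⟩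
  · intro a ha h
    have := code_mem_partsFrom_take hη hL ha
    rw [OverPart.le_iff] at h
    omega

/-! ## The window conditions in terms of rows -/

/-- The conditions on the windows that end in row `j + 1` of a list of rows, where the rows are
numbered from `m` and `v` non-multiples lie below. -/
def WindowsAt (κ r η m v : ℕ) (K : List Row) (j : ℕ) : Prop :=
  (rowAt K j).2.1 + (rowAt K j).2.2.card + (rowAt K (j + 1)).1 + (rowAt K (j + 1)).2.1 +
    tbit κ r (m + j) (rowAt K j).2.1 (v + nonmultiples (K.take j))
      (overlines (K.drop (j + 1))) ≤ κ ∧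
  crossing η (rowAt K j).2.2 (rowAt K (j + 1)).2.2 + ((rowAt K (j + 1)).1 + (rowAt K (j + 1)).2.1 +
    tbit κ r (m + j + 1) (rowAt K (j + 1)).2.1 (v + nonmultiples (K.take (j + 1)))
      (overlines (K.drop (j + 2)))) ≤ κ

theorem windowsAt_cons_succ (κ r η m v : ℕ) (p : Row) (K : List Row) (j : ℕ) :
    WindowsAt κ r η m v (p :: K) (j + 1) ↔ WindowsAt κ r η (m + 1) (v + p.2.2.card) K j := by
  have h1 : m + (j + 1) = m + 1 + j := by omega
  have h2 : ∀ i, v + nonmultiples (List.take (i + 1) (p :: K)) =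
      v + p.2.2.card + nonmultiples (List.take i K) := fun i => by simp [nonmultiples, add_assoc]
  rw [WindowsAt, WindowsAt, h2, h2, h1]
  exact Iff.rfl

theorem tbit_le_one (κ r m f v o : ℕ) : tbit κ r m f v o ≤ 1 :=
  Nat.le_of_lt_succ (Nat.mod_lt _ two_pos)

/-- Past the last row the conditions are automatic, since a window made of residues alone has fewer
than κ parts and a bit adds at most 1. The entry e is arbitrary: no standard window ending in a
higher row contains the overlined multiple of row m. -/
theorem windows_iff_forall {κ r η : ℕ} {R : Finset ℕ} (hRκ : R.card < κ) (m e f : ℕ)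
    {x : Finset ℕ} (hx : x ⊆ R) (v : ℕ) {L : List Row} (hL : ∀ p ∈ L, p.2.2 ⊆ R) :
    Windows κ r η m f x v L ↔ ∀ j, WindowsAt κ r η m v ((e, f, x) :: L) j := by
  induction L generalizing m e f x v with
  | nil =>
    rw [Windows]
    have hc := crossing_le_card (η := η) hx (Finset.empty_subset R)
    constructor
    · rintro h (_ | j)
      · have := tbit_le_one κ r (m + 1) 0 (v + x.card) 0
        simp only [WindowsAt, rowAt, nonmultiples, overlines, List.getD_cons_zero,
          List.getD_cons_succ, List.getD_nil, List.take_zero, List.drop_succ_cons, List.drop_nil,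
          List.map_nil, List.sum_nil, List.take_succ_cons, List.map_cons, List.sum_cons,
          add_zero, zero_add]
        exact ⟨h, by omega⟩
      · rw [windowsAt_cons_succ]
        have h1 := tbit_le_one κ r (m + 1 + j) 0 (v + x.card) 0
        have h2 := tbit_le_one κ r (m + 1 + j + 1) 0 (v + x.card) 0
        have h3 := crossing_le_card (η := η) (Finset.empty_subset R) (Finset.empty_subset R)
        simp only [WindowsAt, rowAt, nonmultiples, overlines, List.getD_nil, List.take_nil,
          List.drop_nil, List.map_nil, List.sum_nil, Finset.card_empty, add_zero, zero_add]
        exact ⟨by omega, by omega⟩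
    · intro h
      have := (h 0).1
      simpa [rowAt, nonmultiples, overlines] using this
  | cons p L ih =>
    obtain ⟨e', f', x'⟩ := p
    rw [List.forall_mem_cons] at hL
    rw [Windows, ih (m + 1) e' f' hL.1 (v + x.card) hL.2]
    constructor
    · rintro ⟨a, b, c⟩ (_ | j)
      · simpa [WindowsAt, rowAt, nonmultiples, overlines] using ⟨a, b⟩
      · exact (windowsAt_cons_succ ..).2 (c j)
    · intro h
      have h0 := h 0
      simp only [WindowsAt, rowAt, nonmultiples, overlines, List.getD_cons_zero,
        List.getD_cons_succ, List.take_zero, List.drop_succ_cons, List.drop_zero,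
        List.map_nil, List.sum_nil, List.take_succ_cons, List.map_cons, List.sum_cons,
        add_zero, zero_add] at h0
      exact ⟨h0.1, h0.2, fun j => (windowsAt_cons_succ ..).1 (h (j + 1))⟩

/-- The conditions on the windows that end in row `j + 1`, for `PlainWindows`. -/
def PlainWindowsAt (N η : ℕ) (K : List Row) (j : ℕ) : Prop :=
  (rowAt K j).2.1 + (rowAt K j).2.2.card + (rowAt K (j + 1)).2.1 ≤ N ∧
  crossing η (rowAt K j).2.2 (rowAt K (j + 1)).2.2 + (rowAt K (j + 1)).2.1 ≤ N

theorem plainWindows_iff_forall {N η : ℕ} {R : Finset ℕ} (hRN : R.card ≤ N) (e f : ℕ)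
    {x : Finset ℕ} (hx : x ⊆ R) {L : List Row} (hL : ∀ p ∈ L, p.2.2 ⊆ R) :
    PlainWindows N η f x L ↔
      (∀ p ∈ L, p.1 = 0) ∧ ∀ j, PlainWindowsAt N η ((e, f, x) :: L) j := by
  induction L generalizing e f x with
  | nil =>
    rw [PlainWindows]
    have hc := crossing_le_card (η := η) hx (Finset.empty_subset R)
    have h3 := crossing_le_card (η := η) (Finset.empty_subset R) (Finset.empty_subset R)
    constructor
    · refine fun h => ⟨by simp, ?_⟩
      rintro (_ | j)
      · simp only [PlainWindowsAt, rowAt, List.getD_cons_zero, List.getD_cons_succ, List.getD_nil]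
        exact ⟨by omega, by omega⟩
      · simp only [PlainWindowsAt, rowAt, List.getD_cons_succ, List.getD_nil, Finset.card_empty]
        exact ⟨by omega, by omega⟩
    · intro h
      have := (h.2 0).1
      simpa [rowAt] using this
  | cons p L ih =>
    obtain ⟨e', f', x'⟩ := p
    rw [List.forall_mem_cons] at hL
    rw [PlainWindows, ih e' f' hL.1 hL.2, List.forall_mem_cons]
    constructor
    · rintro ⟨a, b, c, d, h⟩
      refine ⟨⟨a, d⟩, ?_⟩
      rintro (_ | j)
      · exact ⟨b, c⟩
      · exact h j
    · rintro ⟨⟨a, d⟩, h⟩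
      exact ⟨a, (h 0).1, (h 0).2, d, fun j => h (j + 1)⟩

section

variable {η : ℕ} {L : List Row}

theorem bandEnds_closed (η j : ℕ) :
    BandEnds η (OverPart.plain (η * (j + 1))) (OverPart.plain (η * j)) := by
  rw [bandEnds_iff, OverPart.code_plain, OverPart.code_plain, mul_add, mul_one]
  omega

theorem bandEnds_crossing (η j ρ : ℕ) :
    BandEnds η (OverPart.plain (η * (j + 1) + ρ)) (OverPart.overlined (η * j + ρ + 1)) := by
  have : η * (j + 1) = η * j + η := by ring
  rw [bandEnds_iff, OverPart.code_plain, OverPart.code_overlined]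
  omega

theorem card_between_closed (hη : 0 < η) (hL : ∀ p ∈ L, IsRow η p) (j : ℕ) :
    ((partsFrom η 0 L).between (OverPart.plain (η * j)) (OverPart.plain (η * (j + 1)))).card =
      (rowAt L j).2.1 + (rowAt L j).2.2.card + (rowAt L (j + 1)).1 + (rowAt L (j + 1)).2.1 := by
  rw [between_closed hη hL]
  simp [add_assoc]

theorem card_between_crossing (hη : 0 < η) (hL : ∀ p ∈ L, IsRow η p) (j : ℕ) {ρ : ℕ}
    (hρ : ρ < η) :
    ((partsFrom η 0 L).between (OverPart.overlined (η * j + ρ + 1))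
        (OverPart.plain (η * (j + 1) + ρ))).card =
      ((rowAt L j).2.2.filter (ρ < ·)).card + ((rowAt L (j + 1)).2.2.filter (· ≤ ρ)).card +
        ((rowAt L (j + 1)).1 + (rowAt L (j + 1)).2.1) := by
  rw [between_crossing hη hL _ hρ]
  simp only [Multiset.card_add, Multiset.card_map, Multiset.card_replicate, Finset.card_val]
  omega

theorem sum_size_div_map {x : Finset ℕ} (hx : ∀ ρ ∈ x, 0 < ρ ∧ ρ < η) (j : ℕ) :
    ((x.val.map fun ρ => OverPart.overlined (η * j + ρ)).map fun c => c.size / η).sum =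
      x.card * j := by
  rw [Multiset.map_map, Multiset.map_congr rfl (g := fun _ => j)]
  · simp
  · intro ρ hρ
    have h := hx ρ hρ
    rw [Function.comp_apply, OverPart.size_overlined, Nat.mul_add_div (by omega),
      Nat.div_eq_of_lt h.2, add_zero]

theorem sum_size_div_overlined (hη : 0 < η) (n j : ℕ) :
    ((Multiset.replicate n (OverPart.overlined (η * j))).map fun c => c.size / η).sum = n * j := by
  simp [OverPart.size_overlined, Nat.mul_div_cancel_left _ hη]

theorem sum_size_div_plain (hη : 0 < η) (n j : ℕ) :
    ((Multiset.replicate n (OverPart.plain (η * j))).map fun c => c.size / η).sum = n * j := by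
  simp [OverPart.size_plain, Nat.mul_div_cancel_left _ hη]

/-- The integer parts sum to jκ + e' + f'. Together with the |x| non-multiples of row j in the low
count, e' + f' + |x| = κ - f because the window is full, which leaves (j + 1)κ + f modulo 2. -/
theorem windowParity_closed_iff (hη : 0 < η) (hL : ∀ p ∈ L, IsRow η p) (r j : ℕ) {κ : ℕ}
    (hκ : (rowAt L j).2.1 + (rowAt L j).2.2.card + (rowAt L (j + 1)).1 +
      (rowAt L (j + 1)).2.1 = κ) :
    WindowParity η r (partsFrom η 0 L) (OverPart.plain (η * j)) (OverPart.plain (η * (j + 1))) ↔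
      tbit κ r j (rowAt L j).2.1 (nonmultiples (L.take j)) (overlines (L.drop (j + 1))) = 0 := by
  have h1 := lowNonmultiples_eq hη hL j hη
  rw [add_zero, Finset.filter_false_of_mem fun σ hσ => by
    have := (isRow_rowAt hL (j + 1)).2 σ hσ
    omega, nonmultiples_take_succ, Finset.card_empty] at h1
  have h2 := highMultiples_eq hη hL j (N := OverPart.plain (η * j))
    (by rw [OverPart.code_plain]; omega) (by rw [OverPart.code_plain, mul_add]; omega)
  rw [WindowParity, between_closed hη hL, h1, h2]
  simp only [Multiset.map_add, Multiset.sum_add, sum_size_div_plain hη, sum_size_div_overlined hη,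
    sum_size_div_map (isRow_rowAt hL j).2]
  have e1 : (rowAt L j).2.1 * j + (rowAt L j).2.2.card * j + ((rowAt L (j + 1)).1 * (j + 1) +
      (rowAt L (j + 1)).2.1 * (j + 1)) =
      j * κ + ((rowAt L (j + 1)).1 + (rowAt L (j + 1)).2.1) := by
    rw [← hκ]; ring
  rw [e1, tbit, add_mul, one_mul]
  generalize j * κ = z
  omega

/-- The B residues from row j + 1 enter both the sum of integer parts and the low count, and e'
enters both that sum and the high count. Modulo 2 they cancel, so the condition does not depend on
ρ. -/
theorem windowParity_crossing_iff (hη : 0 < η) (hL : ∀ p ∈ L, IsRow η p) (r j : ℕ) {κ ρ : ℕ}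
    (hρ : ρ < η)
    (hκ : ((rowAt L j).2.2.filter (ρ < ·)).card + ((rowAt L (j + 1)).2.2.filter (· ≤ ρ)).card +
        ((rowAt L (j + 1)).1 + (rowAt L (j + 1)).2.1) = κ) :
    WindowParity η r (partsFrom η 0 L) (OverPart.overlined (η * j + ρ + 1))
        (OverPart.plain (η * (j + 1) + ρ)) ↔
      tbit κ r (j + 1) (rowAt L (j + 1)).2.1 (nonmultiples (L.take (j + 1)))
        (overlines (L.drop (j + 2))) = 0 := by
  have hmul : η * (j + 1) = η * j + η := by ring
  have h1 := lowNonmultiples_eq hη hL j hρ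
  have h2 := highMultiples_eq hη hL j (N := OverPart.overlined (η * j + ρ + 1))
    (by rw [OverPart.code_overlined]; omega) (by rw [OverPart.code_overlined]; omega)
  rw [overlines_drop, show j + 1 + 1 = j + 2 from rfl] at h2
  rw [WindowParity, between_crossing hη hL _ hρ, h1, h2]
  simp only [Multiset.map_add, Multiset.sum_add, sum_size_div_plain hη, sum_size_div_overlined hη,
    sum_size_div_map fun σ hσ => (isRow_rowAt hL j).2 σ (Finset.filter_subset _ _ hσ),
    sum_size_div_map fun σ hσ => (isRow_rowAt hL (j + 1)).2 σ (Finset.filter_subset _ _ hσ)]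
  generalize ((rowAt L j).2.2.filter (ρ < ·)).card = A at *
  generalize ((rowAt L (j + 1)).2.2.filter (· ≤ ρ)).card = B at *
  have e1 : A * j + ((rowAt L (j + 1)).1 * (j + 1) + (rowAt L (j + 1)).2.1 * (j + 1) +
      B * (j + 1)) = j * κ + ((rowAt L (j + 1)).1 + (rowAt L (j + 1)).2.1 + B) := by
    rw [← hκ]; ring
  rw [e1, tbit, add_mul, add_mul, one_mul]
  generalize j * κ = z
  omega

/-- Every window with ends among the parts lies in row `0` or in one of the standard windows. -/
theorem between_le_between (hη : 0 < η) (hL : ∀ p ∈ L, IsRow η p) {lo hi : OverPart}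
    (hlo : lo ∈ partsFrom η 0 L) (hhi : hi ∈ partsFrom η 0 L) (hband : BandEnds η hi lo) :
    hi.size < η ∨ ∃ j, η * (j + 1) ≤ hi.size ∧
      ((partsFrom η 0 L).between lo hi ≤
        (partsFrom η 0 L).between (OverPart.plain (η * j)) (OverPart.plain (η * (j + 1))) ∨
      ∃ ρ < η, (partsFrom η 0 L).between lo hi ≤
        (partsFrom η 0 L).between (OverPart.overlined (η * j + ρ + 1))
          (OverPart.plain (η * (j + 1) + ρ))) := by
  obtain ⟨i, -, hi'⟩ := exists_mem_rowParts hhi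
  rw [zero_add] at hi'
  have hsize := size_mem_rowParts hη (isRow_rowAt hL i) hi'
  cases i with
  | zero => exact .inl (by simpa using hsize.2)
  | succ j =>
    refine .inr ⟨j, hsize.1, ?_⟩
    have mono : ∀ lo' hi' : OverPart, lo'.code ≤ lo.code → hi.code ≤ hi'.code →
        (partsFrom η 0 L).between lo hi ≤ (partsFrom η 0 L).between lo' hi' := by
      intro lo' hi' h1 h2
      refine Multiset.monotone_filter_right _ fun c hc => ?_
      rw [OverPart.le_iff, OverPart.le_iff] at hc ⊢
      exact ⟨h1.trans hc.1, hc.2.trans h2⟩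
    rw [bandEnds_iff] at hband
    have hmul : η * (j + 1) = η * j + η := by ring
    rcases mem_rowParts.1 hi' with ⟨-, rfl⟩ | ⟨-, rfl⟩ | ⟨ρ, hρ, rfl⟩
    · rw [OverPart.code_overlined] at hband
      refine .inl (mono _ _ ?_ ?_) <;> simp only [OverPart.code_plain, OverPart.code_overlined] <;>
        omega
    · rw [OverPart.code_plain] at hband
      refine .inl (mono _ _ ?_ ?_) <;> simp only [OverPart.code_plain] <;> omega
    · have hρ' := (isRow_rowAt hL (j + 1)).2 ρ hρ
      rw [OverPart.code_overlined] at hband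
      -- This code belongs to the plain part jη + ρ, which does not occur because it is not a
      -- multiple of η. Excluding it lets the lower end move up to the overlined part jη + ρ + 1.
      have hne : lo.code ≠ 2 * (η * j + ρ) + 1 := by
        intro h
        obtain ⟨i, -, hi⟩ := exists_mem_rowParts hlo
        rw [zero_add] at hi
        rcases mem_rowParts.1 hi with ⟨-, rfl⟩ | ⟨-, rfl⟩ | ⟨σ, -, rfl⟩
        · rw [OverPart.code_overlined] at h; omega
        · rw [OverPart.code_plain] at h
          exact not_dvd_row (j := j) hρ' ⟨i, by omega⟩
        · rw [OverPart.code_overlined] at h; omega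
      refine .inr ⟨ρ, hρ'.2, mono _ _ ?_ ?_⟩ <;>
        simp only [OverPart.code_plain, OverPart.code_overlined] <;> omega

theorem card_between_row_zero (hη : 0 < η) (hL : ∀ p ∈ L, IsRow η p) {x : Finset ℕ}
    {lo hi : OverPart} (hhi : hi.size < η) :
    ((partsFrom η 0 ((0, 0, x) :: L)).between lo hi).card ≤ x.card := by
  rw [partsFrom, between_add, between_eq_zero (s := partsFrom η _ _), add_zero]
  · refine (Multiset.card_le_card (Multiset.filter_le _ _)).trans ?_
    simp [rowParts]
  · intro a ha
    have := (code_mem_partsFrom hη hL ha).1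
    rw [OverPart.size_eq] at hhi
    right
    omega

/-- Since `tbit` is at most 1, adding it to the number of parts encodes two statements: at most κ
parts, and a vanishing bit when there are exactly κ. A full window contained in a standard one has
the same contents and inherits its parity; conversely, standard windows shrink to windows with ends
among the parts. -/
theorem forall_windowsAt_iff (hη : 0 < η) {κ r : ℕ} {x : Finset ℕ} (hx : x.card < κ)
    (hL : ∀ p ∈ (0, 0, x) :: L, IsRow η p) :
    (∀ j, WindowsAt κ r η 0 0 ((0, 0, x) :: L) j) ↔
      (∀ lo ∈ partsFrom η 0 ((0, 0, x) :: L), ∀ hi ∈ partsFrom η 0 ((0, 0, x) :: L),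
        BandEnds η hi lo → ((partsFrom η 0 ((0, 0, x) :: L)).between lo hi).card ≤ κ) ∧
      (∀ lo ∈ partsFrom η 0 ((0, 0, x) :: L), ∀ hi ∈ partsFrom η 0 ((0, 0, x) :: L),
        BandEnds η hi lo → ((partsFrom η 0 ((0, 0, x) :: L)).between lo hi).card = κ →
          WindowParity η r (partsFrom η 0 ((0, 0, x) :: L)) lo hi) := by
  have hL' : ∀ p ∈ L, IsRow η p := fun p hp => hL p (List.mem_cons_of_mem _ hp)
  constructor
  · intro h
    have key : ∀ lo ∈ partsFrom η 0 ((0, 0, x) :: L), ∀ hi ∈ partsFrom η 0 ((0, 0, x) :: L),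
        BandEnds η hi lo → ((partsFrom η 0 ((0, 0, x) :: L)).between lo hi).card ≤ κ ∧
        (((partsFrom η 0 ((0, 0, x) :: L)).between lo hi).card = κ →
          WindowParity η r (partsFrom η 0 ((0, 0, x) :: L)) lo hi) := by
      intro lo hlo hi hhi hband
      have std : ∀ lo' hi' : OverPart,
          (partsFrom η 0 ((0, 0, x) :: L)).between lo hi ≤
            (partsFrom η 0 ((0, 0, x) :: L)).between lo' hi' →
          ((partsFrom η 0 ((0, 0, x) :: L)).between lo' hi').card ≤ κ →
          (((partsFrom η 0 ((0, 0, x) :: L)).between lo' hi').card = κ →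
            WindowParity η r (partsFrom η 0 ((0, 0, x) :: L)) lo' hi') →
          ((partsFrom η 0 ((0, 0, x) :: L)).between lo hi).card ≤ κ ∧
          (((partsFrom η 0 ((0, 0, x) :: L)).between lo hi).card = κ →
            WindowParity η r (partsFrom η 0 ((0, 0, x) :: L)) lo hi) := by
        intro lo' hi' hle hc hp
        refine ⟨(Multiset.card_le_card hle).trans hc, fun hκ => ?_⟩
        have e := Multiset.eq_of_le_of_card_le hle (by omega)
        exact (windowParity_congr e (by rw [Ne, ← Multiset.card_eq_zero]; omega)).2
          (hp (by rw [← e, hκ]))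
      rcases between_le_between hη hL hlo hhi hband with h0 | ⟨j, -, h0 | ⟨ρ, hρ, h0⟩⟩
      · have := card_between_row_zero hη hL' (x := x) (lo := lo) h0
        exact ⟨by omega, fun _ => by omega⟩
      · have hj := (h j).1
        simp only [zero_add] at hj
        refine std _ _ h0 ?_ fun hc => ?_
        · rw [card_between_closed hη hL]
          omega
        · rw [card_between_closed hη hL] at hc
          rw [windowParity_closed_iff hη hL r j hc]
          omega
      · have hj := (h j).2
        simp only [zero_add] at hj
        rw [crossing_add_le hη] at hj
        have hj := hj ρ hρ
        refine std _ _ h0 ?_ fun hc => ?_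
        · rw [card_between_crossing hη hL _ hρ]
          omega
        · rw [card_between_crossing hη hL _ hρ] at hc
          rw [windowParity_crossing_iff hη hL r j hρ hc]
          omega
    exact ⟨fun lo hlo hi hhi hb => (key lo hlo hi hhi hb).1,
      fun lo hlo hi hhi hb => (key lo hlo hi hhi hb).2⟩
  · rintro ⟨h1, h2⟩ j
    simp only [WindowsAt, zero_add]
    refine ⟨?_, (crossing_add_le hη _ _ _ _).2 fun ρ hρ => ?_⟩
    · have hc := card_between_le h1 (bandEnds_closed η j)
      have hp := windowParity_of_mem (by omega) h2 (bandEnds_closed η j)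
      rw [card_between_closed hη hL] at hc hp
      have hle := tbit_le_one κ r j (rowAt ((0, 0, x) :: L) j).2.1
        (nonmultiples (List.take j ((0, 0, x) :: L)))
        (overlines (List.drop (j + 1) ((0, 0, x) :: L)))
      rcases hc.eq_or_lt with hc | hc
      · have := (windowParity_closed_iff hη hL r j hc).1 (hp hc)
        omega
      · omega
    · have hc := card_between_le h1 (bandEnds_crossing η j ρ)
      have hp := windowParity_of_mem (by omega) h2 (bandEnds_crossing η j ρ)
      rw [card_between_crossing hη hL _ hρ] at hc hp
      have hle := tbit_le_one κ r (j + 1) (rowAt ((0, 0, x) :: L) (j + 1)).2.1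
        (nonmultiples (List.take (j + 1) ((0, 0, x) :: L)))
        (overlines (List.drop (j + 2) ((0, 0, x) :: L)))
      rcases hc.eq_or_lt with hc | hc
      · have := (windowParity_crossing_iff hη hL r j hρ hc).1 (hp hc)
        omega
      · omega

theorem forall_plainWindowsAt_iff (hη : 0 < η) {N : ℕ} {x : Finset ℕ} (hx : x.card ≤ N)
    (hL : ∀ p ∈ (0, 0, x) :: L, IsRow η p) (h0 : ∀ p ∈ L, p.1 = 0) :
    (∀ j, PlainWindowsAt N η ((0, 0, x) :: L) j) ↔
      ∀ lo ∈ partsFrom η 0 ((0, 0, x) :: L), ∀ hi ∈ partsFrom η 0 ((0, 0, x) :: L),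
        BandEnds η hi lo → ((partsFrom η 0 ((0, 0, x) :: L)).between lo hi).card ≤ N := by
  have hL' : ∀ p ∈ L, IsRow η p := fun p hp => hL p (List.mem_cons_of_mem _ hp)
  have he : ∀ j, (rowAt ((0, 0, x) :: L) (j + 1)).1 = 0 := fun j => by
    rw [rowAt, List.getD_cons_succ, List.getD_eq_getElem?_getD]
    cases hj : L[j]? with
    | none => rfl
    | some p => exact h0 p (List.mem_of_getElem? hj)
  constructor
  · intro h lo hlo hi hhi hband
    rcases between_le_between hη hL hlo hhi hband with h0 | ⟨j, -, h0 | ⟨ρ, hρ, h0⟩⟩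
    · exact (card_between_row_zero hη hL' h0).trans hx
    · refine (Multiset.card_le_card h0).trans ?_
      rw [card_between_closed hη hL, he, add_zero]
      exact (h j).1
    · refine (Multiset.card_le_card h0).trans ?_
      rw [card_between_crossing hη hL _ hρ, he, zero_add]
      exact (crossing_add_le hη _ _ _ _).1 (h j).2 ρ hρ
  · intro h j
    refine ⟨?_, (crossing_add_le hη _ _ _ _).2 fun ρ hρ => ?_⟩
    · have hc := card_between_le h (bandEnds_closed η j)
      rwa [card_between_closed hη hL, he, add_zero] at hc
    · have hc := card_between_le h (bandEnds_crossing η j ρ)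
      rwa [card_between_crossing hη hL _ hρ, he, zero_add] at hc

end

/-! ## Rows of a multiset of parts -/

/-- Row `j` of a multiset of parts with residues in `R`. -/
def rowOf (R : Finset ℕ) (η : ℕ) (μ : Multiset OverPart) (j : ℕ) : Row :=
  (μ.count (OverPart.overlined (η * j)), μ.count (OverPart.plain (η * j)),
    R.filter fun ρ => OverPart.overlined (η * j + ρ) ∈ μ)

/-- The multisets of parts whose rows have residues in `R`. -/
structure HasRows (R : Finset ℕ) (η : ℕ) (μ : Multiset OverPart) : Prop where
  pos : ∀ a ∈ μ, 0 < a.size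
  residue : ∀ a ∈ μ, a.size % η = 0 ∨ a.size % η ∈ R
  plain : ∀ a ∈ μ, ¬ a.IsOverlined → η ∣ a.size
  once : ∀ t, μ.count (OverPart.overlined t) ≤ 1

theorem overlined_injective : Function.Injective OverPart.overlined := fun a b h => by
  have := congrArg OverPart.size h
  exact this

theorem plain_injective : Function.Injective OverPart.plain := fun a b h => by
  have := congrArg OverPart.size h
  exact this

theorem plain_ne_overlined (a b : ℕ) : OverPart.plain a ≠ OverPart.overlined b := fun h => by
  have := congrArg OverPart.code h
  rw [OverPart.code_plain, OverPart.code_overlined] at this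
  omega

theorem count_partsFrom {η : ℕ} (hη : 0 < η) {K : List Row} (hK : ∀ p ∈ K, IsRow η p)
    (a : OverPart) :
    (partsFrom η 0 K).count a =
      (rowParts η (a.size / η) (rowAt K (a.size / η))).count a := by
  have h1 := Nat.div_add_mod a.size η
  have h2 := Nat.mod_lt a.size hη
  rw [partsFrom_eq_add η 0 (a.size / η), Multiset.count_add, Multiset.count_add, zero_add,
    (Multiset.count_eq_zero (s := partsFrom η 0 _)).2,
    (Multiset.count_eq_zero (s := partsFrom η (_ + 1) _)).2, zero_add, add_zero]
  · intro h
    have := (size_mem_partsFrom hη (fun p hp => hK p (List.mem_of_mem_drop hp)) h).1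
    rw [mul_add, mul_one] at this
    omega
  · intro h
    have h3 := (size_mem_partsFrom hη (fun p hp => hK p (List.mem_of_mem_take hp)) h).2
    have h4 : η * (0 + (K.take (a.size / η)).length) ≤ η * (a.size / η) :=
      Nat.mul_le_mul_left _ (by rw [List.length_take]; omega)
    omega

theorem count_overlined_mul {η : ℕ} (hη : 0 < η) {K : List Row} (hK : ∀ p ∈ K, IsRow η p)
    (j : ℕ) : (partsFrom η 0 K).count (OverPart.overlined (η * j)) = (rowAt K j).1 := by
  have hr := isRow_rowAt hK j
  rw [count_partsFrom hη hK, OverPart.size_overlined, Nat.mul_div_cancel_left _ hη,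
    Multiset.count, countP_rowParts, if_pos rfl, if_neg (plain_ne_overlined _ _).symm,
    Finset.filter_false_of_mem, Finset.card_empty]
  · rfl
  · intro ρ hρ h
    have := overlined_injective h
    have := hr.2 ρ hρ
    omega

theorem count_plain_mul {η : ℕ} (hη : 0 < η) {K : List Row} (hK : ∀ p ∈ K, IsRow η p)
    (j : ℕ) : (partsFrom η 0 K).count (OverPart.plain (η * j)) = (rowAt K j).2.1 := by
  rw [count_partsFrom hη hK, OverPart.size_plain, Nat.mul_div_cancel_left _ hη,
    Multiset.count, countP_rowParts, if_pos rfl, if_neg (plain_ne_overlined _ _),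
    Finset.filter_false_of_mem fun ρ _ => plain_ne_overlined _ _, Finset.card_empty]
  simp

theorem count_overlined_add {η : ℕ} (hη : 0 < η) {K : List Row} (hK : ∀ p ∈ K, IsRow η p)
    (j : ℕ) {ρ : ℕ} (hρ : 0 < ρ ∧ ρ < η) :
    (partsFrom η 0 K).count (OverPart.overlined (η * j + ρ)) =
      if ρ ∈ (rowAt K j).2.2 then 1 else 0 := by
  rw [count_partsFrom hη hK, OverPart.size_overlined, Nat.mul_add_div hη,
    Nat.div_eq_of_lt hρ.2, add_zero, Multiset.count, countP_rowParts,
    if_neg (fun h => by have := overlined_injective h; omega),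
    if_neg (plain_ne_overlined _ _).symm]
  have : ∀ σ, (OverPart.overlined (η * j + ρ) = OverPart.overlined (η * j + σ)) = (ρ = σ) :=
    fun σ => propext ⟨fun h => by have := overlined_injective h; omega, fun h => by rw [h]⟩
  simp only [this, Finset.filter_eq]
  split_ifs <;> simp

theorem rowOf_partsFrom {η : ℕ} (hη : 0 < η) {R : Finset ℕ} (hR : ∀ ρ ∈ R, 0 < ρ ∧ ρ < η)
    {K : List Row} (hK : ∀ p ∈ K, IsRow η p) {j : ℕ} (hj : (rowAt K j).2.2 ⊆ R) :
    rowOf R η (partsFrom η 0 K) j = rowAt K j := by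
  refine Prod.ext (count_overlined_mul hη hK j) (Prod.ext (count_plain_mul hη hK j) ?_)
  ext ρ
  rw [rowOf, Finset.mem_filter]
  constructor
  · rintro ⟨h1, h2⟩
    by_contra h
    rw [← Multiset.one_le_count_iff_mem, count_overlined_add hη hK j (hR ρ h1), if_neg h] at h2
    omega
  · intro h
    refine ⟨hj h, ?_⟩
    rw [← Multiset.one_le_count_iff_mem, count_overlined_add hη hK j (hR ρ (hj h)), if_pos h]

theorem HasRows.isRow {R : Finset ℕ} {η : ℕ} {μ : Multiset OverPart} (h : HasRows R η μ)
    (hR : ∀ ρ ∈ R, 0 < ρ ∧ ρ < η) (j : ℕ) : IsRow η (rowOf R η μ j) :=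
  ⟨h.once _, fun ρ hρ => hR ρ (Finset.filter_subset _ _ hρ)⟩

theorem HasRows.partsFrom_rowOf {R : Finset ℕ} {η : ℕ} {μ : Multiset OverPart}
    (h : HasRows R η μ) (hη : 0 < η) (hR : ∀ ρ ∈ R, 0 < ρ ∧ ρ < η) {N : ℕ}
    (hN : ∀ a ∈ μ, a.size < η * N) :
    partsFrom η 0 ((List.range N).map (rowOf R η μ)) = μ := by
  have hK : ∀ p ∈ (List.range N).map (rowOf R η μ), IsRow η p := fun p hp => by
    obtain ⟨j, -, rfl⟩ := List.mem_map.1 hp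
    exact h.isRow hR j
  have hrow : ∀ j < N, rowAt ((List.range N).map (rowOf R η μ)) j = rowOf R η μ j := by
    intro j hj
    simp [rowAt, List.getD_eq_getElem?_getD, hj]
  ext a
  have hdm := Nat.div_add_mod a.size η
  have hmod := Nat.mod_lt a.size hη
  rcases lt_or_ge a.size (η * N) with hlt | hge
  · have hj : a.size / η < N := Nat.div_lt_of_lt_mul hlt
    rcases OverPart.eq_overlined_or_eq_plain a with ha | ha
    · rcases Nat.eq_zero_or_pos (a.size % η) with h0 | h0
      · rw [ha, ← hdm, h0, add_zero, count_overlined_mul hη hK, hrow _ hj]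
        rfl
      · rw [ha, ← hdm, count_overlined_add hη hK _ ⟨h0, hmod⟩, hrow _ hj, rowOf, hdm, ← ha]
        have h1 := h.once a.size
        rw [← ha] at h1
        split_ifs with hc
        · rw [Finset.mem_filter, hdm, ← ha] at hc
          have := Multiset.one_le_count_iff_mem.2 hc.2
          omega
        · rw [Finset.mem_filter, hdm, ← ha] at hc
          refine (Multiset.count_eq_zero.2 fun hm => hc ⟨?_, hm⟩).symm
          exact (h.residue a hm).resolve_left (by omega)
    · rcases Nat.eq_zero_or_pos (a.size % η) with h0 | h0
      · rw [ha, ← hdm, h0, add_zero, count_plain_mul hη hK, hrow _ hj]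
        rfl
      · rw [count_partsFrom hη hK, Multiset.count_eq_zero.2, Multiset.count_eq_zero.2]
        · intro hm
          have := h.plain a hm (by rw [ha]; exact not_isOverlined_plain _)
          have := Nat.mod_eq_zero_of_dvd this
          omega
        · intro hm
          rcases mem_rowParts.1 hm with ⟨-, e⟩ | ⟨-, e⟩ | ⟨ρ, -, e⟩
          · exact plain_ne_overlined _ _ (ha.symm.trans e)
          · have := plain_injective (ha.symm.trans e)
            omega
          · exact plain_ne_overlined _ _ (ha.symm.trans e)
  · rw [Multiset.count_eq_zero.2, Multiset.count_eq_zero.2]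
    · intro hm
      have := hN a hm
      omega
    · intro hm
      have := (size_mem_partsFrom hη hK hm).2
      rw [List.length_map, List.length_range, zero_add] at this
      omega

theorem sum_size_rowParts (η j : ℕ) (p : Row) :
    ((rowParts η j p).map OverPart.size).sum = rowWeight η j p := by
  simp only [rowParts, Multiset.map_add, Multiset.sum_add, Multiset.map_replicate,
    Multiset.sum_replicate, Multiset.map_map, Function.comp_def, OverPart.size_overlined,
    OverPart.size_plain, rowWeight, smul_eq_mul]
  rw [← Finset.sum_eq_multiset_sum, Finset.sum_add_distrib, Finset.sum_const, smul_eq_mul]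
  ring

theorem sum_size_partsFrom (η j : ℕ) (L : List Row) :
    ((partsFrom η j L).map OverPart.size).sum = listWeight η j L := by
  induction L generalizing j with
  | nil => rfl
  | cons p L ih =>
    rw [partsFrom, Multiset.map_add, Multiset.sum_add, ih, sum_size_rowParts, listWeight]

theorem isRow_of_mem_rowSet {κ η : ℕ} {R : Finset ℕ} (hR : ∀ ρ ∈ R, 0 < ρ ∧ ρ < η) {p : Row}
    (hp : p ∈ rowSet κ R) : IsRow η p := by
  simp only [rowSet, Finset.mem_product, Finset.mem_range, Finset.mem_powerset] at hp
  exact ⟨by omega, fun ρ hρ => hR ρ (hp.2.2 hρ)⟩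

theorem subset_of_mem_rowSet {κ : ℕ} {R : Finset ℕ} {p : Row} (hp : p ∈ rowSet κ R) :
    p.2.2 ⊆ R := by
  simp only [rowSet, Finset.mem_product, Finset.mem_powerset] at hp
  exact hp.2.2

theorem hasRows_partsFrom {η : ℕ} (hη : 0 < η) {R : Finset ℕ}
    (hR : ∀ ρ ∈ R, 0 < ρ ∧ ρ < η) {x : Finset ℕ} (hx : x ⊆ R) {L : List Row}
    (hL : ∀ p ∈ L, IsRow η p) (hLR : ∀ p ∈ L, p.2.2 ⊆ R) :
    HasRows R η (partsFrom η 0 ((0, 0, x) :: L)) := by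
  have hK : ∀ p ∈ ((0, 0, x) :: L), IsRow η p :=
    List.forall_mem_cons.2 ⟨⟨zero_le_one, fun ρ hρ => hR ρ (hx hρ)⟩, hL⟩
  have hKR : ∀ j, (rowAt ((0, 0, x) :: L) j).2.2 ⊆ R := by
    intro j
    rw [rowAt, List.getD_eq_getElem?_getD]
    cases hj : ((0, 0, x) :: L)[j]? with
    | none => simp
    | some p =>
      exact (List.forall_mem_cons.2 ⟨hx, hLR⟩ : ∀ p ∈ ((0, 0, x) :: L), p.2.2 ⊆ R) p
        (List.mem_of_getElem? hj)
  constructor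
  · intro a ha
    rw [partsFrom, Multiset.mem_add] at ha
    rcases ha with ha | ha
    · rcases mem_rowParts.1 ha with ⟨h, -⟩ | ⟨h, -⟩ | ⟨ρ, hρ, rfl⟩
      · exact absurd rfl h
      · exact absurd rfl h
      · have := hR ρ (hx hρ)
        rw [OverPart.size_overlined]
        omega
    · have := (size_mem_partsFrom hη hL ha).1
      rw [zero_add, mul_one] at this
      omega
  · intro a ha
    obtain ⟨j, -, h⟩ := exists_mem_rowParts ha
    rw [zero_add] at h
    rcases mem_rowParts.1 h with ⟨-, rfl⟩ | ⟨-, rfl⟩ | ⟨ρ, hρ, rfl⟩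
    · left; simp [OverPart.size_overlined]
    · left; simp [OverPart.size_plain]
    · right
      have := hR ρ (hKR j hρ)
      rw [OverPart.size_overlined, Nat.mul_add_mod, Nat.mod_eq_of_lt this.2]
      exact hKR j hρ
  · intro a ha h
    obtain ⟨j, -, h⟩ := exists_mem_rowParts ha
    rw [zero_add] at h
    rcases mem_rowParts.1 h with ⟨-, rfl⟩ | ⟨-, rfl⟩ | ⟨ρ, hρ, rfl⟩
    · exact absurd (isOverlined_overlined _) ‹_›
    · exact Dvd.intro _ rfl
    · exact absurd (isOverlined_overlined _) ‹_›
  · intro t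
    rw [← Nat.div_add_mod t η]
    rcases Nat.eq_zero_or_pos (t % η) with h | h
    · rw [h, add_zero, count_overlined_mul hη hK]
      exact (isRow_rowAt hK _).1
    · rw [count_overlined_add hη hK _ ⟨h, Nat.mod_lt _ hη⟩]
      split_ifs <;> simp

/-- The parts not exceeding `η`. -/
theorem countP_le_plain {η : ℕ} (hη : 0 < η) {x : Finset ℕ} {P : Row} {L : List Row}
    (hK : ∀ p ∈ (0, 0, x) :: P :: L, IsRow η p) :
    (partsFrom η 0 ((0, 0, x) :: P :: L)).countP (· ≤ OverPart.plain η) =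
      x.card + (P.1 + P.2.1) := by
  have h := card_between_closed hη hK 0
  rw [zero_add, mul_one, mul_zero] at h
  simp only [rowAt, List.getD_cons_zero, List.getD_cons_succ, zero_add, add_assoc] at h
  rw [← h, Multiset.countP_eq_card_filter, Multiset.between]
  congr 1
  refine Multiset.filter_congr fun a ha => ?_
  have hx := (List.forall_mem_cons.1 hK).1.2
  rw [partsFrom, Multiset.mem_add] at ha
  suffices OverPart.plain 0 ≤ a by simp [this]
  rw [OverPart.le_iff, OverPart.code_plain]
  rcases ha with ha | ha
  · rcases mem_rowParts.1 ha with ⟨h, -⟩ | ⟨h, -⟩ | ⟨ρ, hρ, rfl⟩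
    · exact absurd rfl h
    · exact absurd rfl h
    · have := hx ρ hρ
      rw [OverPart.code_overlined]
      omega
  · have := (code_mem_partsFrom hη (List.forall_mem_cons.1 hK).2 ha).1
    rw [zero_add, mul_one] at this
    omega

/-! ## The conditions on partitions in terms of rows -/

theorem allowedResidue_iff {lam η : ℕ} {α : Fin lam → ℕ} (hα : ∀ i, α i < η) (a : ℕ) :
    AllowedResidue α η a ↔ a % η = 0 ∨ a % η ∈ Finset.univ.image α := by
  simp only [AllowedResidue, Nat.ModEq, Nat.zero_mod, Nat.mod_eq_of_lt (hα _), Finset.mem_image,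
    Finset.mem_univ, true_and, eq_comm]

section Over

variable {lam η κ r : ℕ} {α : Fin lam → ℕ} {R x : Finset ℕ}

/-- Below the overlined 2η only the standard windows with j = 0 remain, as row 0 alone has fewer
than κ parts. The closed one starts at size 0, so it has |x| + e + f parts and is dominated by a
crossing one. For the converse, take a ρ at which `crossing` attains its maximum. -/
theorem exists_full_window_iff (hη : 0 < η) (hR : ∀ ρ ∈ R, 0 < ρ ∧ ρ < η) (hRκ : R.card < κ)
    (hx : x ⊆ R) {P : Row} {L : List Row} (hK : ∀ p ∈ (0, 0, x) :: P :: L, IsRow η p)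
    (h : ∀ lo ∈ partsFrom η 0 ((0, 0, x) :: P :: L),
      ∀ hi ∈ partsFrom η 0 ((0, 0, x) :: P :: L), BandEnds η hi lo →
        ((partsFrom η 0 ((0, 0, x) :: P :: L)).between lo hi).card ≤ κ) :
    (∃ i a b, ((partsFrom η 0 ((0, 0, x) :: P :: L)).sort (· ≥ ·))[i]? = some a ∧
      ((partsFrom η 0 ((0, 0, x) :: P :: L)).sort (· ≥ ·))[i + (κ - 1)]? = some b ∧
      a < OverPart.overlined (2 * η) ∧ BandEnds η a b) ↔
    crossing η x P.2.2 + (P.1 + P.2.1) = κ := by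
  have hle : crossing η x P.2.2 + (P.1 + P.2.1) ≤ κ := by
    rw [crossing_add_le hη]
    intro ρ hρ
    have := card_between_le h (bandEnds_crossing η 0 ρ)
    rwa [card_between_crossing hη hK _ hρ] at this
  constructor
  · intro hs
    obtain ⟨lo, hlo, hi, hhi, hN, hband, hc⟩ := exists_window_of_slice (by omega) h hs
    rw [OverPart.lt_iff, OverPart.code_overlined] at hN
    have hxc := Finset.card_le_card hx
    rcases between_le_between hη hK hlo hhi hband with h0 | ⟨j, hj, h0⟩
    · have := card_between_row_zero hη (List.forall_mem_cons.1 hK).2 (x := x) (lo := lo) h0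
      omega
    · have hj0 : j = 0 := by
        by_contra hj0
        have : η * 2 ≤ η * (j + 1) := Nat.mul_le_mul_left _ (by omega)
        rw [OverPart.size_eq] at hj
        omega
      subst hj0
      rcases h0 with h0 | ⟨ρ, hρ, h0⟩
      · have h1 := Multiset.card_le_card h0
        rw [card_between_closed hη hK, hc] at h1
        simp only [rowAt, List.getD_cons_zero, List.getD_cons_succ, zero_add] at h1
        have := card_le_crossing_left hη (x' := P.2.2) fun ρ hρ => (hR ρ (hx hρ)).1
        omega
      · have h1 := Multiset.card_le_card h0
        rw [card_between_crossing hη hK _ hρ, hc] at h1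
        simp only [rowAt, List.getD_cons_zero, List.getD_cons_succ] at h1
        have := le_crossing hρ x P.2.2
        omega
  · intro hc
    obtain ⟨ρ, hρ, e⟩ := exists_crossing_eq hη x P.2.2
    refine exists_slice_of_window (by omega) ?_ (bandEnds_crossing η 0 ρ) ?_
    · rw [OverPart.lt_iff, OverPart.code_overlined, OverPart.code_plain]
      omega
    · rw [card_between_crossing hη hK _ hρ, ← hc, ← e]
      rfl

theorem isOverB0_iff (hη : 0 < η) (hR : ∀ ρ ∈ R, 0 < ρ ∧ ρ < η)
    (hα : ∀ a, AllowedResidue α η a ↔ a % η = 0 ∨ a % η ∈ R) (hRκ : R.card < κ)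
    (hx : x ⊆ R) {P : Row} {L : List Row} (hL : ∀ p ∈ P :: L, IsRow η p)
    (hLR : ∀ p ∈ P :: L, p.2.2 ⊆ R) {n : ℕ} {π : Overpartition n}
    (hπ : π.parts = partsFrom η 0 ((0, 0, x) :: P :: L)) :
    IsOverB0 α η (κ + 1) r π ↔ OverRows κ r η x (P :: L) := by
  have hK : ∀ p ∈ (0, 0, x) :: P :: L, IsRow η p :=
    List.forall_mem_cons.2 ⟨⟨zero_le_one, fun ρ hρ => hR ρ (hx hρ)⟩, hL⟩
  have hrows := hasRows_partsFrom hη hR hx hL hLR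
  have hxc := Finset.card_le_card hx
  have hwin := forall_windowsAt_iff (r := r) hη (κ := κ) (by omega) hK
  rw [← windows_iff_forall hRκ 0 0 0 hx 0 hLR] at hwin
  have hsmall : π.fLe η = x.card + (P.1 + P.2.1) := by
    rw [Overpartition.fLe, hπ]
    exact countP_le_plain hη hK
  have hov : OverPart.overlined η ∉ π.parts ↔ P.1 = 0 := by
    have := count_overlined_mul hη hK 1
    rw [mul_one] at this
    rw [hπ, ← Multiset.count_eq_zero, this]
    rfl
  have hsr : SmallRows κ r η x (P :: L) ↔ x.card + (P.1 + P.2.1) ≤ r ∧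
      (x.card + (P.1 + P.2.1) = r → P.1 = 0 → crossing η x P.2.2 + (P.1 + P.2.1) = κ) := Iff.rfl
  have hfull := exists_full_window_iff hη hR hRκ hx hK
  rw [OverRows, hwin, hsr]
  rw [← hπ] at hfull hrows ⊢
  constructor
  · rintro ⟨h1, h2, h3, h4, h5, h6⟩
    have hgap := (gap_iff_card_between_le π.parts).1 h3
    refine ⟨⟨hgap, (parity_iff_windowParity (by omega) π hgap).1 h6⟩, hsmall ▸ h4,
      fun a b => ?_⟩
    exact (hfull hgap).1 (h5 (hsmall.trans a) (hov.2 b))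
  · rintro ⟨⟨hgap, hpar⟩, h4, h5⟩
    refine ⟨fun a ha => (hα _).2 (hrows.residue a ha), hrows.plain,
      (gap_iff_card_between_le π.parts).2 hgap, hsmall ▸ h4, fun a b => ?_,
      (parity_iff_windowParity (by omega) π hgap).2 hpar⟩
    exact (hfull hgap).2 (h5 (hsmall.symm.trans a) (hov.1 b))

theorem IsOverB0.hasRows {n k : ℕ} {π : Overpartition n} (h : IsOverB0 α η k r π)
    (hα : ∀ a, AllowedResidue α η a ↔ a % η = 0 ∨ a % η ∈ R) : HasRows R η π.parts :=
  ⟨π.parts_pos, fun a ha => (hα _).1 (h.residue a ha), h.nonoverlined, π.overlined_once⟩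

/-- The plain multiples of `η` lie in a window. -/
theorem count_plain_le {N : ℕ} {μ : Multiset OverPart}
    (h : ∀ lo ∈ μ, ∀ hi ∈ μ, BandEnds η hi lo → (μ.between lo hi).card ≤ N) (t : ℕ) :
    μ.count (OverPart.plain t) ≤ N := by
  have hb : BandEnds η (OverPart.plain t) (OverPart.plain t) := by
    rw [bandEnds_iff, OverPart.code_plain]
    omega
  refine le_trans ?_ (card_between_le h hb)
  rw [Multiset.count, Multiset.countP_eq_card_filter]
  refine Multiset.card_le_card (Multiset.monotone_filter_right _ fun c hc => ?_)
  rw [← hc]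
  exact ⟨le_rfl, le_rfl⟩

end Over

/-! ### Ordinary partitions as overpartitions -/

section Bressoud

/-- The part of an overpartition that corresponds to a part of an ordinary partition: overlined
unless it is a multiple of `η`. -/
def toOverPart (η a : ℕ) : OverPart := toLex (a, decide (η ∣ a))

variable {lam η κ r : ℕ} {α : Fin lam → ℕ} {R x : Finset ℕ}

theorem size_toOverPart (a : ℕ) : (toOverPart η a).size = a := rfl

theorem toOverPart_of_dvd {a : ℕ} (h : η ∣ a) : toOverPart η a = OverPart.plain a := by
  simp [toOverPart, OverPart.plain, h]

theorem toOverPart_of_not_dvd {a : ℕ} (h : ¬ η ∣ a) : toOverPart η a = OverPart.overlined a := by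
  simp [toOverPart, OverPart.overlined, h]

theorem code_toOverPart (a : ℕ) :
    (toOverPart η a).code = 2 * a + if η ∣ a then 1 else 0 := by
  split_ifs with h
  · rw [toOverPart_of_dvd h, OverPart.code_plain]
  · rw [toOverPart_of_not_dvd h, OverPart.code_overlined, add_zero]

theorem toOverPart_injective : Function.Injective (toOverPart η) := fun a b h => by
  have := congrArg OverPart.size h
  exact this

theorem toOverPart_le_iff (a b : ℕ) : toOverPart η a ≤ toOverPart η b ↔ a ≤ b := by
  rw [OverPart.le_iff, code_toOverPart, code_toOverPart]
  by_cases h : a = b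
  · subst h; simp
  · split_ifs <;> omega

theorem sort_map_toOverPart (s : Multiset ℕ) :
    (s.map (toOverPart η)).sort (· ≥ ·) = (s.sort (· ≥ ·)).map (toOverPart η) :=
  (Multiset.map_sort (r := (· ≥ ·)) (r' := (· ≥ ·)) (f := toOverPart η) (s := s)
    fun a _ b _ => (toOverPart_le_iff b a).symm).symm

/-- The only delicate case is b + η = a. Then a and b are both multiples of η or both not, so
`toOverPart` marks them alike and the strictness conditions agree. -/
theorem gap_toOverPart_iff (a b : ℕ) :
    (b + η ≤ a ∧ (η ∣ a → b + η < a)) ↔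
      ((toOverPart η b).shift η ≤ toOverPart η a ∧
        (¬ (toOverPart η a).IsOverlined → (toOverPart η b).shift η < toOverPart η a)) := by
  rw [OverPart.le_iff, OverPart.lt_iff, OverPart.isOverlined_iff, OverPart.code_shift,
    code_toOverPart, code_toOverPart]
  have e : b + η = a → (η ∣ a ↔ η ∣ b) := by
    rintro rfl
    simp
  by_cases h : b + η = a
  · have e := e h
    by_cases hb : η ∣ b
    · simp only [hb, e.2 hb, if_true, true_implies]; omega
    · have ha : ¬ η ∣ a := fun h => hb (e.1 h)
      simp only [hb, ha, if_false, false_implies, and_true]; omega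
  · split_ifs <;> omega

theorem gap_map_iff (s : Multiset ℕ) (N : ℕ) :
    (∀ i a b, (s.sort (· ≥ ·))[i]? = some a → (s.sort (· ≥ ·))[i + N]? = some b →
      b + η ≤ a ∧ (η ∣ a → b + η < a)) ↔
    ∀ lo ∈ s.map (toOverPart η), ∀ hi ∈ s.map (toOverPart η), BandEnds η hi lo →
      ((s.map (toOverPart η)).between lo hi).card ≤ N := by
  rw [← gap_iff_card_between_le, sort_map_toOverPart]
  simp only [List.getElem?_map, Option.map_eq_some_iff]
  constructor
  · rintro h i _ _ ⟨a, ha, rfl⟩ ⟨b, hb, rfl⟩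
    exact (gap_toOverPart_iff a b).1 (h i a b ha hb)
  · intro h i a b ha hb
    exact (gap_toOverPart_iff a b).2 (h i _ _ ⟨a, ha, rfl⟩ ⟨b, hb, rfl⟩)

theorem count_overlined_map_toOverPart (s : Multiset ℕ) (t : ℕ) :
    (s.map (toOverPart η)).count (OverPart.overlined t) = if η ∣ t then 0 else s.count t := by
  split_ifs with h
  · refine Multiset.count_eq_zero.2 fun hm => ?_
    obtain ⟨a, -, e⟩ := Multiset.mem_map.1 hm
    have : a = t := congrArg OverPart.size e
    subst this
    rw [toOverPart_of_dvd h] at e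
    exact plain_ne_overlined _ _ e
  · rw [← toOverPart_of_not_dvd h, Multiset.count_map_eq_count' _ _ toOverPart_injective]

theorem IsBressoudB.hasRows {n k j : ℕ} {π : Nat.Partition n} (h : IsBressoudB j α η k r π)
    (hα : ∀ a, AllowedResidue α η a ↔ a % η = 0 ∨ a % η ∈ R) :
    HasRows R η (π.parts.map (toOverPart η)) := by
  refine ⟨?_, ?_, ?_, fun t => ?_⟩
  · intro a ha
    obtain ⟨b, hb, rfl⟩ := Multiset.mem_map.1 ha
    exact π.parts_pos hb
  · intro a ha
    obtain ⟨b, hb, rfl⟩ := Multiset.mem_map.1 ha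
    exact (hα _).1 (h.residue b hb)
  · intro a ha hn
    obtain ⟨b, hb, rfl⟩ := Multiset.mem_map.1 ha
    by_contra hd
    rw [size_toOverPart] at hd
    rw [toOverPart_of_not_dvd hd] at hn
    exact hn (isOverlined_overlined _)
  · rw [count_overlined_map_toOverPart]
    split_ifs with hd
    · exact zero_le_one
    · by_contra! hc
      exact hd (h.repeated t (Multiset.count_pos.1 (by omega)) hc)

theorem isBressoudB_iff (hη : 0 < η)
    (hR : ∀ ρ ∈ R, 0 < ρ ∧ ρ < η)
    (hα : ∀ a, AllowedResidue α η a ↔ a % η = 0 ∨ a % η ∈ R) (hRκ : R.card < κ)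
    (hx : x ⊆ R) {P : Row} {L : List Row} (hL : ∀ p ∈ P :: L, IsRow η p)
    (hLR : ∀ p ∈ P :: L, p.2.2 ⊆ R) (h0 : ∀ p ∈ P :: L, p.1 = 0) {n : ℕ} {π : Nat.Partition n}
    (hπ : π.parts.map (toOverPart η) = partsFrom η 0 ((0, 0, x) :: P :: L)) :
    IsBressoudB 1 α η κ r π ↔ PlainRows κ r η x (P :: L) := by
  have hK : ∀ p ∈ (0, 0, x) :: P :: L, IsRow η p :=
    List.forall_mem_cons.2 ⟨⟨zero_le_one, fun ρ hρ => hR ρ (hx hρ)⟩, hL⟩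
  have hrows := hasRows_partsFrom hη hR hx hL hLR
  have hxc := Finset.card_le_card hx
  have hwin := forall_plainWindowsAt_iff hη (N := κ - 1) (by omega) hK h0
  have hsmall : π.parts.countP (fun a => a ≤ η) = x.card + P.2.1 := by
    have := countP_le_plain hη hK
    rw [← hπ, Multiset.countP_map, h0 P List.mem_cons_self, zero_add] at this
    rw [← this, Multiset.countP_eq_card_filter]
    congr 1
    refine Multiset.filter_congr fun a _ => ?_
    rw [← toOverPart_of_dvd (dvd_refl η), toOverPart_le_iff]
  have hsr : SmallPlainRows r x (P :: L) ↔ x.card + P.2.1 + 1 ≤ r := Iff.rfl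
  rw [PlainRows, plainWindows_iff_forall (by omega) 0 0 hx hLR, and_iff_right h0, hwin, ← hπ,
    ← gap_map_iff, hsr]
  rw [← hπ] at hrows
  constructor
  · rintro ⟨h1, h2, h3, h4, h5⟩
    refine ⟨h3, ?_⟩
    rw [hsmall] at h4
    omega
  · rintro ⟨h3, h4⟩
    refine ⟨fun a ha => ?_, fun a ha hc => ?_, h3, ?_, fun i a b _ _ _ => ?_⟩
    · exact (hα _).2 (hrows.residue _ (Multiset.mem_map_of_mem _ ha))
    · by_contra hd
      have := hrows.once a
      rw [count_overlined_map_toOverPart, if_neg hd] at this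
      omega
    · rw [hsmall]
      omega
    -- For j = 1 the modulus is 2 - 1 = 1.
    · exact Int.modEq_one

end Bressoud

/-! ## Generating functions -/

/-- Each row is recovered by `rowOf`. The lengths must agree because empty rows at the end add no
parts. -/
theorem partsFrom_injective {η : ℕ} (hη : 0 < η) {R : Finset ℕ} (hR : ∀ ρ ∈ R, 0 < ρ ∧ ρ < η)
    {K K' : List Row} (hK : ∀ p ∈ K, IsRow η p) (hK' : ∀ p ∈ K', IsRow η p)
    (hKR : ∀ p ∈ K, p.2.2 ⊆ R) (hKR' : ∀ p ∈ K', p.2.2 ⊆ R) (hlen : K.length = K'.length)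
    (h : partsFrom η 0 K = partsFrom η 0 K') : K = K' := by
  have sub : ∀ {K : List Row}, (∀ p ∈ K, p.2.2 ⊆ R) → ∀ j, (rowAt K j).2.2 ⊆ R := by
    intro K hK j
    rw [rowAt, List.getD_eq_getElem?_getD]
    cases hj : K[j]? with
    | none => simp
    | some p => exact hK p (List.mem_of_getElem? hj)
  refine List.ext_getElem hlen fun j h1 h2 => ?_
  have e1 := rowOf_partsFrom hη hR hK (sub hKR j)
  have e2 := rowOf_partsFrom hη hR hK' (sub hKR' j)
  rw [h, e2] at e1
  simpa [rowAt, h1, h2] using e1.symm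

theorem mem_cons_rowLists {κ η n : ℕ} {R x : Finset ℕ} (hR : ∀ ρ ∈ R, 0 < ρ ∧ ρ < η)
    (hx : x ⊆ R) {L : List Row} (hL : L ∈ rowLists κ R n) :
    (∀ p ∈ (0, 0, x) :: L, IsRow η p) ∧ (∀ p ∈ (0, 0, x) :: L, p.2.2 ⊆ R) ∧ L.length = n := by
  rw [mem_rowLists] at hL
  exact ⟨List.forall_mem_cons.2 ⟨⟨zero_le_one, fun ρ hρ => hR ρ (hx hρ)⟩,
    fun p hp => isRow_of_mem_rowSet hR (hL.2 p hp)⟩,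
    List.forall_mem_cons.2 ⟨hx, fun p hp => subset_of_mem_rowSet (hL.2 p hp)⟩, hL.1⟩

open Classical in
/-- A family of multisets of parts, described by conditions on rows, is a union of finite sets over
which one can sum by rows. -/
theorem exists_truncation {S : Type*} {η κ : ℕ} (hη : 0 < η) {R : Finset ℕ}
    (hR : ∀ ρ ∈ R, 0 < ρ ∧ ρ < η) (parts : S → Multiset OverPart)
    (hinj : Function.Injective parts) (size : S → ℕ)
    (hsize : ∀ s, ((parts s).map OverPart.size).sum = size s) (Φ : Finset ℕ → List Row → Prop)
    (n : ℕ)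
    (hrows : ∀ s, (∀ a ∈ parts s, a.size < η * (n + 2)) → ∃ x ⊆ R, ∃ L ∈ rowLists κ R (n + 1),
      Φ x L ∧ parts s = partsFrom η 0 ((0, 0, x) :: L))
    (hparts : ∀ x ⊆ R, ∀ L ∈ rowLists κ R (n + 1), Φ x L →
      ∃ s, parts s = partsFrom η 0 ((0, 0, x) :: L)) :
    ∃ F : Finset S, (∀ s, s ∈ F ↔ ∀ a ∈ parts s, a.size < η * (n + 2)) ∧
      ∀ {A : Type} [CommRing A] (q : A), ∑ s ∈ F, q ^ size s =
        ∑ x ∈ R.powerset, ∑ L ∈ rowLists κ R (n + 1),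
          if Φ x L then q ^ listWeight η 0 ((0, 0, x) :: L) else 0 := by
  set T := (R.powerset ×ˢ rowLists κ R (n + 1)).filter fun p => Φ p.1 p.2 with hT
  have memT : ∀ p, p ∈ T ↔ (p.1 ⊆ R ∧ p.2 ∈ rowLists κ R (n + 1)) ∧ Φ p.1 p.2 := by
    intro p
    rw [hT, Finset.mem_filter, Finset.mem_product, Finset.mem_powerset]
  have hex : ∀ p : T, ∃ s, parts s = partsFrom η 0 ((0, 0, p.1.1) :: p.1.2) := fun p =>
    have h := (memT p.1).1 p.2
    hparts _ h.1.1 _ h.1.2 h.2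
  choose g hg using hex
  have ginj : Function.Injective g := by
    intro p p' e
    have h := (memT p.1).1 p.2
    have h' := (memT p'.1).1 p'.2
    obtain ⟨a1, a2, a3⟩ := mem_cons_rowLists hR h.1.1 h.1.2
    obtain ⟨b1, b2, b3⟩ := mem_cons_rowLists hR h'.1.1 h'.1.2
    have := partsFrom_injective hη hR a1 b1 a2 b2 (by simp [a3, b3]) (by rw [← hg, ← hg, e])
    simp only [List.cons.injEq, Prod.mk.injEq, true_and] at this
    exact Subtype.ext (Prod.ext this.1 this.2)
  refine ⟨T.attach.image g, fun s => ?_, fun {A} _ q => ?_⟩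
  · rw [Finset.mem_image]
    constructor
    · rintro ⟨p, -, rfl⟩ a ha
      have h := (memT p.1).1 p.2
      obtain ⟨a1, a2, a3⟩ := mem_cons_rowLists hR h.1.1 h.1.2
      rw [hg] at ha
      have := (size_mem_partsFrom hη a1 ha).2
      rwa [List.length_cons, a3, zero_add] at this
    · intro hs
      obtain ⟨x, hx, L, hL, hΦ, e⟩ := hrows s hs
      exact ⟨⟨(x, L), (memT _).2 ⟨⟨hx, hL⟩, hΦ⟩⟩, Finset.mem_attach _ _,
        hinj ((hg _).trans e.symm)⟩
  · rw [Finset.sum_image fun a _ b _ h => ginj h, ← Finset.sum_product', ← Finset.sum_filter,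
      ← hT, ← Finset.sum_attach T]
    refine Finset.sum_congr rfl fun p _ => ?_
    rw [← hsize, hg, sum_size_partsFrom]

/-- The empty row contributes 1, and every other row weighs at least ηj. -/
theorem sum_pow_rowWeight_le {y : ℝ} (hy : 0 ≤ y) (hy1 : y ≤ 1) (η κ : ℕ) (R : Finset ℕ)
    (j : ℕ) :
    ∑ p ∈ rowSet κ R, y ^ rowWeight η j p ≤ 1 + (rowSet κ R).card * (y ^ η) ^ j := by
  have h : ∀ p ∈ rowSet κ R,
      y ^ rowWeight η j p ≤ (if p = (0, 0, ∅) then 1 else 0) + (y ^ η) ^ j := by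
    rintro ⟨e, f, x⟩ -
    rw [← pow_mul]
    split_ifs with hp
    · exact (pow_le_one₀ hy hy1).trans (le_add_of_nonneg_right (by positivity))
    · rw [zero_add]
      refine pow_le_pow_of_le_one hy hy1 ?_
      have : 1 ≤ e + f + x.card := by
        by_contra! hc
        refine hp ?_
        have hx : x = ∅ := Finset.card_eq_zero.1 (by omega)
        rw [hx, show e = 0 by omega, show f = 0 by omega]
      calc η * j = η * j * 1 := (mul_one _).symm
        _ ≤ η * j * (e + f + x.card) := Nat.mul_le_mul_left _ this
        _ ≤ rowWeight η j (e, f, x) := Nat.le_add_right _ _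
  refine (Finset.sum_le_sum h).trans ?_
  rw [Finset.sum_add_distrib, Finset.sum_const, nsmul_eq_mul, Finset.sum_ite_eq']
  gcongr
  split_ifs <;> norm_num

theorem sum_pow_listWeight_le {y : ℝ} (hy : 0 ≤ y) (hy1 : y ≤ 1) (η κ : ℕ) (R : Finset ℕ)
    (n m : ℕ) :
    ∑ L ∈ rowLists κ R n, y ^ listWeight η m L ≤
      ∏ j ∈ Finset.range n, (1 + (rowSet κ R).card * (y ^ η) ^ (m + j)) := by
  induction n generalizing m with
  | zero => simp [rowLists, listWeight]
  | succ n ih =>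
    rw [sum_rowLists_succ, Finset.prod_range_succ']
    simp only [listWeight, pow_add y]
    rw [← Finset.sum_mul_sum, mul_comm]
    refine mul_le_mul ((ih (m + 1)).trans_eq ?_) (by simpa using sum_pow_rowWeight_le hy hy1 η κ R m)
      (Finset.sum_nonneg fun _ _ => by positivity) (Finset.prod_nonneg fun _ _ => by positivity)
    refine Finset.prod_congr rfl fun j _ => ?_
    rw [show m + 1 + j = m + (j + 1) by omega]

open Classical in
-- Dropping Φ and the weight of row 0 leaves a product over the rows. It is bounded by the
-- exponential of a geometric series, independently of n.
theorem exists_bound {y : ℝ} (hy : 0 ≤ y) (hy1 : y < 1) {η : ℕ} (hη : 0 < η) (κ : ℕ)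
    (R : Finset ℕ) (Φ : Finset ℕ → List Row → Prop) :
    ∃ C, ∀ n, ∑ x ∈ R.powerset, ∑ L ∈ rowLists κ R (n + 1),
      (if Φ x L then y ^ listWeight η 0 ((0, 0, x) :: L) else 0) ≤ C := by
  have hY : y ^ η < 1 := pow_lt_one₀ hy hy1 hη.ne'
  have hY0 : 0 ≤ y ^ η := by positivity
  have hs : Summable fun j : ℕ => ((rowSet κ R).card : ℝ) * (y ^ η) ^ (1 + j) := by
    simp only [pow_add, pow_one]
    exact ((summable_geometric_of_lt_one hY0 hY).mul_left _).mul_left _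
  refine ⟨R.powerset.card * Real.exp (∑' j : ℕ, ((rowSet κ R).card : ℝ) * (y ^ η) ^ (1 + j)),
    fun n => ?_⟩
  rw [← nsmul_eq_mul, ← Finset.sum_const]
  refine Finset.sum_le_sum fun x _ => ?_
  calc ∑ L ∈ rowLists κ R (n + 1), (if Φ x L then y ^ listWeight η 0 ((0, 0, x) :: L) else 0)
      ≤ ∑ L ∈ rowLists κ R (n + 1), y ^ listWeight η 1 L := by
        refine Finset.sum_le_sum fun L _ => ?_
        split_ifs
        · exact pow_le_pow_of_le_one hy hy1.le (Nat.le_add_left _ _)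
        · positivity
    _ ≤ ∏ j ∈ Finset.range (n + 1), (1 + (rowSet κ R).card * (y ^ η) ^ (1 + j)) :=
        sum_pow_listWeight_le hy hy1.le η κ R (n + 1) 1
    _ ≤ ∏ j ∈ Finset.range (n + 1), Real.exp ((rowSet κ R).card * (y ^ η) ^ (1 + j)) :=
        Finset.prod_le_prod (fun _ _ => by positivity) fun j _ => by
          rw [add_comm]; exact Real.add_one_le_exp _
    _ ≤ _ := by
        rw [← Real.exp_sum]
        exact Real.exp_le_exp.2 (hs.sum_le_tsum _ fun _ _ => by positivity)

/-- The generating function of a family of multisets of parts is the limit of the sums over the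
multisets with boundedly many rows. -/
theorem tendsto_tsum_card {X : ℕ → Type} {η : ℕ} (hη : 0 < η)
    (parts : (Σ n, X n) → Multiset OverPart) (F : ℕ → Finset (Σ n, X n))
    (hF : ∀ n s, s ∈ F n ↔ ∀ a ∈ parts s, a.size < η * (n + 2)) {q : ℂ} {C : ℝ}
    (hC : ∀ n, ∑ s ∈ F n, ‖q‖ ^ s.1 ≤ C) :
    Summable (fun n => (Nat.card (X n) : ℂ) * q ^ n) ∧
      Filter.Tendsto (fun n => ∑ s ∈ F n, q ^ s.1) Filter.atTop
        (nhds (∑' n, (Nat.card (X n) : ℂ) * q ^ n)) := by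
  have hmono : Monotone F := by
    intro m n hmn s hs
    rw [hF] at hs ⊢
    exact fun a ha => (hs a ha).trans_le (Nat.mul_le_mul_left _ (by omega))
  have hmem : ∀ s, ∃ n, s ∈ F n := by
    intro s
    -- The total size bounds every part and serves as the truncation index.
    refine ⟨((parts s).map OverPart.size).sum, (hF _ _).2 fun a ha => ?_⟩
    have h1 := Multiset.single_le_sum (fun _ _ => Nat.zero_le _) _
      (Multiset.mem_map_of_mem OverPart.size ha)
    nlinarith
  have hT := Filter.tendsto_atTop_finset_of_monotone hmono hmem
  have hs : Summable fun s : Σ n, X n => q ^ s.1 := by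
    refine Summable.of_norm ?_
    simp only [norm_pow]
    refine summable_of_sum_le (c := C) (fun s => by positivity) fun u => ?_
    obtain ⟨n, hn⟩ := (hT.eventually (Filter.eventually_ge_atTop u)).exists
    exact (Finset.sum_le_sum_of_subset_of_nonneg hn fun _ _ _ => by positivity).trans (hC n)
  have e : ∀ n, ∑' c : X n, q ^ (⟨n, c⟩ : Σ n, X n).1 = (Nat.card (X n) : ℂ) * q ^ n := by
    intro n
    change ∑' _ : X n, q ^ n = _
    rw [tsum_const, nsmul_eq_mul]
  have h1 := hs.sigma
  have h2 := hs.tsum_sigma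
  simp only [e] at h1 h2
  exact ⟨h1, h2 ▸ hs.hasSum.comp hT⟩

/-! ### Truncation of both families to boundedly many rows -/

section Truncation

variable {lam η κ r : ℕ} {α : Fin lam → ℕ} {R : Finset ℕ}

theorem HasRows.exists_rows (hη : 0 < η) (hR : ∀ ρ ∈ R, 0 < ρ ∧ ρ < η) {μ : Multiset OverPart}
    (h : HasRows R η μ) (hle : ∀ t, μ.count (OverPart.plain t) ≤ κ) {n : ℕ}
    (hn : ∀ a ∈ μ, a.size < η * (n + 2)) :
    ∃ x ⊆ R, ∃ P, ∃ L, P :: L ∈ rowLists κ R (n + 1) ∧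
      μ = partsFrom η 0 ((0, 0, x) :: P :: L) := by
  have e := h.partsFrom_rowOf hη hR hn
  -- Multiples of η in row 0 would have size 0, but parts are positive.
  have e0 : rowOf R η μ 0 = (0, 0, (rowOf R η μ 0).2.2) := by
    refine Prod.ext ?_ (Prod.ext ?_ rfl)
    · exact Multiset.count_eq_zero.2 fun hm => (h.pos _ hm).ne' (by simp [OverPart.size_overlined])
    · exact Multiset.count_eq_zero.2 fun hm => (h.pos _ hm).ne' (by simp [OverPart.size_plain])
  rw [List.range_succ_eq_map, List.map_cons, e0, List.range_succ_eq_map, List.map_cons,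
    List.map_cons] at e
  refine ⟨_, Finset.filter_subset _ _, _, _, mem_rowLists.2 ⟨by simp, fun p hp => ?_⟩, e.symm⟩
  have hp : ∃ j, rowOf R η μ j = p := by
    simp only [List.map_map, List.mem_cons, List.mem_map] at hp
    rcases hp with rfl | ⟨j, -, rfl⟩
    · exact ⟨_, rfl⟩
    · exact ⟨_, rfl⟩
  obtain ⟨j, rfl⟩ := hp
  simp only [rowSet, Finset.mem_product, Finset.mem_range, Finset.mem_powerset]
  exact ⟨Nat.lt_succ_of_le (h.once _), Nat.lt_succ_of_le (hle _), Finset.filter_subset _ _⟩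

theorem exists_cons_of_mem_rowLists {n : ℕ} {K : List Row} (hK : K ∈ rowLists κ R (n + 1)) :
    ∃ P L, K = P :: L := by
  cases K with
  | nil => simp [mem_rowLists] at hK
  | cons P L => exact ⟨P, L, rfl⟩

open Classical in
theorem exists_truncation_overB0 (hη : 0 < η) (hR : ∀ ρ ∈ R, 0 < ρ ∧ ρ < η)
    (hα : ∀ a, AllowedResidue α η a ↔ a % η = 0 ∨ a % η ∈ R) (hRκ : R.card < κ) (n : ℕ) :
    ∃ F : Finset (Σ n, {π : Overpartition n // IsOverB0 α η (κ + 1) r π}),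
      (∀ s, s ∈ F ↔ ∀ a ∈ s.2.1.parts, a.size < η * (n + 2)) ∧
      ∀ {A : Type} [CommRing A] (q : A), ∑ s ∈ F, q ^ s.1 =
        ∑ x ∈ R.powerset, ∑ L ∈ rowLists κ R (n + 1),
          if OverRows κ r η x L then q ^ listWeight η 0 ((0, 0, x) :: L) else 0 := by
  refine exists_truncation hη hR
    (fun s : Σ n, {π : Overpartition n // IsOverB0 α η (κ + 1) r π} => s.2.1.parts) ?_
    (fun s => s.1) (fun s => s.2.1.parts_sum) _ n ?_ ?_
  · rintro ⟨n, π, hπ⟩ ⟨n', π', hπ'⟩ (h : π.parts = π'.parts)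
    obtain rfl : n = n' := by rw [← π.parts_sum, ← π'.parts_sum, h]
    obtain rfl : π = π' := Overpartition.ext h
    rfl
  · rintro ⟨m, π, hπ⟩ (hs : ∀ a ∈ π.parts, _)
    have hgap := (gap_iff_card_between_le π.parts).1 hπ.gap
    obtain ⟨x, hx, P, L, hL, e⟩ :=
      (hπ.hasRows hα).exists_rows hη hR (κ := κ) (fun t => count_plain_le hgap t) hs
    obtain ⟨h1, h2, -⟩ := mem_cons_rowLists hR hx hL
    exact ⟨x, hx, P :: L, hL, (isOverB0_iff hη hR hα hRκ hx (List.forall_mem_cons.1 h1).2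
      (List.forall_mem_cons.1 h2).2 e).1 hπ, e⟩
  · intro x hx K hK hΦ
    obtain ⟨h1, h2, -⟩ := mem_cons_rowLists hR hx hK
    obtain ⟨P, L, rfl⟩ := exists_cons_of_mem_rowLists hK
    have hrows := hasRows_partsFrom hη hR hx (List.forall_mem_cons.1 h1).2
      (List.forall_mem_cons.1 h2).2
    exact ⟨⟨_, ⟨⟨_, hrows.pos, rfl, hrows.once⟩, (isOverB0_iff hη hR hα hRκ hx
      (List.forall_mem_cons.1 h1).2 (List.forall_mem_cons.1 h2).2 rfl).2 hΦ⟩⟩, rfl⟩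

theorem map_size_map_toOverPart {μ : Multiset OverPart}
    (h : ∀ a ∈ μ, toOverPart η a.size = a) :
    (μ.map OverPart.size).map (toOverPart η) = μ := by
  rw [Multiset.map_map]
  exact (Multiset.map_congr rfl h).trans (Multiset.map_id' μ)

open Classical in
theorem exists_truncation_bressoudB (hη : 0 < η) (hR : ∀ ρ ∈ R, 0 < ρ ∧ ρ < η)
    (hα : ∀ a, AllowedResidue α η a ↔ a % η = 0 ∨ a % η ∈ R) (hRκ : R.card < κ) (n : ℕ) :
    ∃ F : Finset (Σ n, {π : Nat.Partition n // IsBressoudB 1 α η κ r π}),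
      (∀ s, s ∈ F ↔ ∀ a ∈ s.2.1.parts.map (toOverPart η), a.size < η * (n + 2)) ∧
      ∀ {A : Type} [CommRing A] (q : A), ∑ s ∈ F, q ^ s.1 =
        ∑ x ∈ R.powerset, ∑ L ∈ rowLists κ R (n + 1),
          if PlainRows κ r η x L then q ^ listWeight η 0 ((0, 0, x) :: L) else 0 := by
  refine exists_truncation hη hR
    (fun s : Σ n, {π : Nat.Partition n // IsBressoudB 1 α η κ r π} =>
      s.2.1.parts.map (toOverPart η)) ?_ (fun s => s.1) (fun s => ?_) _ n ?_ ?_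
  · rintro ⟨n, π, hπ⟩ ⟨n', π', hπ'⟩ h
    have h : π.parts = π'.parts := Multiset.map_injective toOverPart_injective h
    obtain rfl : n = n' := by rw [← π.parts_sum, ← π'.parts_sum, h]
    obtain rfl : π = π' := Nat.Partition.ext h
    rfl
  · rw [Multiset.map_map]
    exact (congrArg Multiset.sum (Multiset.map_id' _)).trans s.2.1.parts_sum
  · rintro ⟨m, π, hπ⟩ (hs : ∀ a ∈ π.parts.map (toOverPart η), _)
    have hgap := (gap_map_iff π.parts (κ - 1)).1 hπ.gap
    obtain ⟨x, hx, P, L, hL, e⟩ := (hπ.hasRows hα).exists_rows hη hR (κ := κ)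
      (fun t => (count_plain_le hgap t).trans (Nat.sub_le _ _)) hs
    obtain ⟨h1, h2, -⟩ := mem_cons_rowLists hR hx hL
    have h0 : ∀ p ∈ P :: L, p.1 = 0 := by
      intro p hp
      obtain ⟨j, hj, rfl⟩ := List.mem_iff_getElem.1 hp
      have hc := count_overlined_mul hη h1 (j + 1)
      rw [← e, count_overlined_map_toOverPart, if_pos (Dvd.intro _ rfl)] at hc
      simpa [rowAt, List.getD_eq_getElem?_getD, List.getElem?_eq_getElem hj] using hc.symm
    exact ⟨x, hx, P :: L, hL, (isBressoudB_iff hη hR hα hRκ hx (List.forall_mem_cons.1 h1).2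
      (List.forall_mem_cons.1 h2).2 h0 e).1 hπ, e⟩
  · intro x hx K hK hΦ
    obtain ⟨h1, h2, -⟩ := mem_cons_rowLists hR hx hK
    obtain ⟨P, L, rfl⟩ := exists_cons_of_mem_rowLists hK
    have hrows := hasRows_partsFrom hη hR hx (List.forall_mem_cons.1 h1).2
      (List.forall_mem_cons.1 h2).2
    have hxc := Finset.card_le_card hx
    have h0 := ((plainWindows_iff_forall (by omega) 0 0 hx (List.forall_mem_cons.1 h2).2).1
      hΦ.1).1
    -- There are no overlined multiples in the rows, by h0, so the size of a part determines whether
    -- it is overlined.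
    have e := map_size_map_toOverPart (η := η)
      (μ := partsFrom η 0 ((0, 0, x) :: P :: L)) fun a ha => by
        obtain ⟨j, -, h⟩ := exists_mem_rowParts ha
        have hr := isRow_rowAt h1 j
        rw [zero_add] at h
        rcases mem_rowParts.1 h with ⟨h, -⟩ | ⟨-, rfl⟩ | ⟨ρ, hρ, rfl⟩
        · refine absurd ?_ h
          rw [rowAt, List.getD_eq_getElem?_getD]
          cases hj : ((0, 0, x) :: P :: L)[j]? with
          | none => rfl
          | some p =>
            rcases List.mem_cons.1 (List.mem_of_getElem? hj) with rfl | hp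
            · rfl
            · exact h0 p hp
        · exact toOverPart_of_dvd (Dvd.intro _ rfl)
        · exact toOverPart_of_not_dvd (not_dvd_row (hr.2 ρ hρ))
    exact ⟨⟨_, ⟨⟨(partsFrom η 0 ((0, 0, x) :: P :: L)).map OverPart.size, fun {i} hi => by
        obtain ⟨a, ha, rfl⟩ := Multiset.mem_map.1 hi
        exact hrows.pos a ha, rfl⟩, (isBressoudB_iff hη hR hα hRκ hx
      (List.forall_mem_cons.1 h1).2 (List.forall_mem_cons.1 h2).2 h0 e).2 hΦ⟩⟩, e⟩

end Truncation

/-! ### Passage to the limit -/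

theorem theorem2p2 (lam η : ℕ) (hη : 0 < η) (α : Fin lam → ℕ)
    (hα_pos : ∀ i, 0 < α i) (hα_mono : StrictMono α) (hα_lt : ∀ i, α i < η)
    (hα_symm : ∀ i : Fin lam, (α i : ℤ) = (η : ℤ) - (α i.rev : ℤ))
    (k r : ℕ) (hkr : r < k) (hr : lam ≤ r) (hk : (lam : ℤ) < (k : ℤ) - 1)
    (q : ℂ) (hq : ‖q‖ < 1) :
    Summable (fun n : ℕ => (overB0 α η k r n : ℂ) * q ^ n) ∧
    Summable (fun n : ℕ => (bressoudB 1 α η (k - 1) r n : ℂ) * q ^ n) ∧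
    Multipliable (fun i : ℕ => 1 - (-q ^ η) * (q ^ η) ^ i) ∧
    ∑' n : ℕ, (overB0 α η k r n : ℂ) * q ^ n =
      qPochhammerInf (-q ^ η) (q ^ η) *
        ∑' n : ℕ, (bressoudB 1 α η (k - 1) r n : ℂ) * q ^ n := by
  classical
  obtain ⟨κ, rfl⟩ : ∃ κ, k = κ + 1 := ⟨k - 1, by omega⟩
  rw [Nat.add_sub_cancel]
  set R : Finset ℕ := Finset.univ.image α with hRdef
  have hR : ∀ ρ ∈ R, 0 < ρ ∧ ρ < η := by
    intro ρ hρ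
    obtain ⟨i, -, rfl⟩ := Finset.mem_image.1 hρ
    exact ⟨hα_pos i, hα_lt i⟩
  have hRκ : R.card < κ := by
    have : R.card ≤ lam := Finset.card_image_le.trans_eq (by simp)
    omega
  have hα := allowedResidue_iff (α := α) hα_lt
  -- The row formulas hold over every commutative ring, so the same finite sets serve for the sums
  -- in q and for the bounds in ‖q‖.
  choose F hF hFsum using fun n => exists_truncation_overB0 (r := r) hη hR hα hRκ n
  choose G hG hGsum using fun n => exists_truncation_bressoudB (r := r) hη hR hα hRκ n
  obtain ⟨C, hC⟩ := exists_bound (norm_nonneg q) hq hη κ R (OverRows κ r η)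
  obtain ⟨D, hD⟩ := exists_bound (norm_nonneg q) hq hη κ R (PlainRows κ r η)
  obtain ⟨hs1, ht1⟩ := tendsto_tsum_card hη (fun s => s.2.1.parts) F hF (q := q) (C := C)
    fun n => (hFsum n ‖q‖).trans_le (hC n)
  obtain ⟨hs2, ht2⟩ := tendsto_tsum_card hη (fun s => s.2.1.parts.map (toOverPart η)) G hG
    (q := q) (C := D) fun n => (hGsum n ‖q‖).trans_le (hD n)
  have hQ : ‖q ^ η‖ < 1 := by
    rw [norm_pow]
    exact pow_lt_one₀ (norm_nonneg q) hq hη.ne'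
  have hfac : ∀ i : ℕ, 1 - (-q ^ η) * (q ^ η) ^ i = 1 + q ^ (η * (i + 1)) := fun i => by
    rw [mul_add, mul_one, pow_add, pow_mul]
    ring
  have hm : Multipliable fun i : ℕ => 1 - (-q ^ η) * (q ^ η) ^ i := by
    simp only [sub_eq_add_neg]
    refine multipliable_one_add_of_summable ?_
    simp only [norm_neg, norm_mul, norm_pow] at hQ ⊢
    exact (summable_geometric_of_lt_one (by positivity) hQ).mul_left _
  refine ⟨hs1, hs2, hm, ?_⟩
  -- The truncation n has n + 2 rows, and row 0 gives no factor. So the finite identity contains n +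
  -- 1 factors of the product.
  have hp := (Filter.tendsto_add_atTop_iff_nat 1).2 hm.hasProd.tendsto_prod_nat
  refine tendsto_nhds_unique ht1 ((hp.mul ht2).congr fun n => ?_)
  rw [hFsum, hGsum, sum_overRows_eq q hη (by omega) hRκ hR]
  simp only [hfac]
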